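/- Theorem 3.2 (uniqueness). Let $2\le d\le 4$, let $\Omega\subset\mathbb R^d$ be a bounded domain (open and connected) with boundary of class $C^2$, and let $0<T<\infty$, $\kappa>0$, $\nu>0$ and $\frac{2d}{d+2}<p<\infty$. Write $p'=\frac{p}{p-1}$ and $Q_T=\Omega\times(0,T)$. Let $\mathcal V$ be the space of divergence-free fields in $C_0^\infty(\Omega)^d$; for $1\le q<\infty$ let $\mathbf V_q$ be the closure of $\mathcal V$ in $W^{1,q}(\Omega)^d$, and let $\mathbf V=\mathbf V_2$. Let $v_0\in\mathbf V\cap\mathbf V_p$ and $f\in L^{p'}(0,T;L^{p'}(\Omega)^d)$. A weak solution of the generalised Navier–Stokes–Voigt problem $$\partial_t(v-\kappa\Delta v)+\operatorname{div}(v\otimes v)+\nabla\pi-\nu\operatorname{div}\big(|D(v)|^{p-2}D(v)\big)=f,\quad \operatorname{div}v=0\ \text{ in }Q_T,$$ $$v=v_0\ \text{ in }\Omega\times\{0\},\qquad v=0\ \text{ on }\partial\Omega\times(0,T),$$ where $D(v)=\frac12(\nabla v+(\nabla v)^{\top})$, is a function $v$ such that 1. $v\in L^\infty(0,T;\mathbf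 V)\cap L^p(0,T;\mathbf V_p)$; 2. $\partial_t v\in L^2(0,T;\mathbf V)$, where $\partial_t v$ is the distributional time derivative; 3. $v(0)=v_0$ in the sense that $\lim_{t\to0^+}\int_\Omega v(t)\cdot\psi\,dx=\int_\Omega v_0\cdot\psi\,dx$ for all $\psi\in\mathcal V$ (a limit up to null sets of times, as $v$ is a class of functions modulo null sets); 4. for every smooth $\varphi:\Omega\times[0,T)\to\mathbb R^d$ with compact support in $\Omega\times[0,T)$ and $\operatorname{div}\varphi(t)=0$ for all $t$, $$-\int_0^T\!\!\int_\Omega v\cdot\partial_t\varphi\,dx\,dt-\kappa\int_0^T\!\!\int_\Omega\nabla v:\nabla\partial_t\varphi\,dx\,dt+\nu\int_0^T\!\!\int_\Omega|D(v)|^{p-2}D(v):D(\varphi)\,dx\,dt$$ $$=\int_\Omega v_0\cdot\varphi(0)\,dx+\kappa\int_\Omega\nabla v_0:\nabla\varphi(0)\,dx+\int_0^T\!\!\int_\Omega f\cdot\varphi\,dx\,dt+\int_0^T\!\!\int_\Omega v\otimes v:\nabla\varphi\,dx\,dt .$$ Then the weak solution is unique: if $v_1$ and $v_2$ are weak solutions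 with the same data $v_0$ and $f$, then $v_1(t)=v_2(t)$ in $\mathbf V$ for almost every $t\in(0,T)$. -/

import Mathlib

open MeasureTheory Set Filter Topology
open scoped ENNReal ContDiff

noncomputable section

namespace NSV

/-- Vectors of `ℝ^d` with the Euclidean norm. -/
abbrev Vec (d : ℕ) : Type := EuclideanSpace ℝ (Fin d)

/-- Tensors in `ℝ^{d×d}`; the norm is the Frobenius norm and the inner product is the
contraction `A : B = ∑ i j, A i j * B i j`. -/
abbrev Mat (d : ℕ) : Type := EuclideanSpace ℝ (Fin d × Fin d)

variable {d : ℕ}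

/-- The (classical) gradient `(∇φ)_{ij} = ∂φ_i / ∂x_j`. -/
def grad (φ : Vec d → Vec d) (x : Vec d) : Mat d :=
  WithLp.toLp 2 fun ij => (fderiv ℝ φ x (EuclideanSpace.single ij.2 1)) ij.1

/-- The (classical) divergence, the trace of the gradient. -/
def divergence (φ : Vec d → Vec d) (x : Vec d) : ℝ := ∑ i, grad φ x (i, i)

/-- The symmetric part `(A + Aᵀ) / 2`. -/
def symPart (A : Mat d) : Mat d :=
  WithLp.toLp 2 fun ij => (A (ij.1, ij.2) + A (ij.2, ij.1)) / 2

/-- The tensor product `(u ⊗ w)_{ij} = u_i w_j`. -/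
def outer (u w : Vec d) : Mat d := WithLp.toLp 2 fun ij => u ij.1 * w ij.2

/-- The power-law stress `|D|^{p-2} D`, with value `0` at `D = 0`. -/
def powerLaw (p : ℝ) (D : Mat d) : Mat d := ‖D‖ ^ (p - 2) • D

/-- `Ω` has a boundary of class `C²`: near each boundary point, `Ω` is the set where a `C²`
function with non-vanishing derivative is negative. -/
def HasC2Boundary (Ω : Set (Vec d)) : Prop :=
  ∀ x ∈ frontier Ω, ∃ U : Set (Vec d), IsOpen U ∧ x ∈ U ∧
    ∃ ρ : Vec d → ℝ, ContDiffOn ℝ 2 ρ U ∧ fderiv ℝ ρ x ≠ 0 ∧ Ω ∩ U = {y ∈ U | ρ y < 0}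

/-- The space `𝒱` of divergence-free fields in `C_0^∞(Ω)^d` (extended by zero). -/
structure IsSolenoidal (Ω : Set (Vec d)) (φ : Vec d → Vec d) : Prop where
  smooth : ContDiff ℝ ∞ φ
  compact : HasCompactSupport φ
  supp : tsupport φ ⊆ Ω
  div_eq_zero : ∀ x, divergence φ x = 0

theorem grad_zero : grad (0 : Vec d → Vec d) = 0 := by
  funext x; ext ij; simp [grad]

theorem grad_add {φ ψ : Vec d → Vec d} (hφ : ContDiff ℝ ∞ φ) (hψ : ContDiff ℝ ∞ ψ) :
    grad (φ + ψ) = grad φ + grad ψ := by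
  funext x; ext ij
  simp [grad, fderiv_add (hφ.differentiable (by simp) x) (hψ.differentiable (by simp) x)]

theorem grad_smul (c : ℝ) {φ : Vec d → Vec d} (hφ : ContDiff ℝ ∞ φ) :
    grad (c • φ) = c • grad φ := by
  funext x; ext ij
  simp [grad, fderiv_const_smul (hφ.differentiable (by simp) x)]

theorem IsSolenoidal.zero (Ω : Set (Vec d)) : IsSolenoidal Ω 0 where
  smooth := contDiff_const
  compact := HasCompactSupport.zero
  supp := by simp [tsupport]
  div_eq_zero x := by simp [divergence, grad_zero]

theorem IsSolenoidal.add {Ω : Set (Vec d)} {φ ψ : Vec d → Vec d}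
    (hφ : IsSolenoidal Ω φ) (hψ : IsSolenoidal Ω ψ) : IsSolenoidal Ω (φ + ψ) where
  smooth := hφ.smooth.add hψ.smooth
  compact := hφ.compact.add hψ.compact
  supp := (tsupport_add φ ψ).trans (union_subset hφ.supp hψ.supp)
  div_eq_zero x := by
    have h1 := hφ.div_eq_zero x
    have h2 := hψ.div_eq_zero x
    simp only [divergence] at h1 h2 ⊢
    simp [grad_add hφ.smooth hψ.smooth, Finset.sum_add_distrib, h1, h2]

theorem IsSolenoidal.smul {Ω : Set (Vec d)} (c : ℝ) {φ : Vec d → Vec d}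
    (hφ : IsSolenoidal Ω φ) : IsSolenoidal Ω (c • φ) where
  smooth := contDiff_const.smul hφ.smooth
  compact := hφ.compact.smul_left (f := fun _ => c)
  supp := (closure_mono (Function.support_const_smul_subset c φ)).trans hφ.supp
  div_eq_zero x := by
    have h1 := hφ.div_eq_zero x
    simp only [divergence] at h1 ⊢
    simp [grad_smul c hφ.smooth, ← Finset.mul_sum, h1]

/-- The image of `𝒱` in `L^q(Ω)^d × L^q(Ω)^{d×d}` under `φ ↦ (φ, ∇φ)`. On this image the norm of
the product is equivalent to the norm of `W^{1,q}(Ω)^d`. -/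
def solenoidalGraph (Ω : Set (Vec d)) (q : ℝ≥0∞) :
    Submodule ℝ (Lp (Vec d) q (volume.restrict Ω) × Lp (Mat d) q (volume.restrict Ω)) where
  carrier := {w | ∃ φ, IsSolenoidal Ω φ ∧
    w.1 =ᵐ[volume.restrict Ω] φ ∧ w.2 =ᵐ[volume.restrict Ω] grad φ}
  zero_mem' := ⟨0, IsSolenoidal.zero Ω, Lp.coeFn_zero _ _ _, by
    rw [grad_zero]; exact Lp.coeFn_zero _ _ _⟩
  add_mem' := by
    rintro a b ⟨φ, hφ, h1, h2⟩ ⟨ψ, hψ, h3, h4⟩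
    refine ⟨φ + ψ, hφ.add hψ, (Lp.coeFn_add _ _).trans (h1.add h3), ?_⟩
    rw [grad_add hφ.smooth hψ.smooth]
    exact (Lp.coeFn_add _ _).trans (h2.add h4)
  smul_mem' := by
    rintro c a ⟨φ, hφ, h1, h2⟩
    refine ⟨c • φ, hφ.smul c, (Lp.coeFn_smul _ _).trans (h1.const_smul c), ?_⟩
    rw [grad_smul c hφ.smooth]
    exact (Lp.coeFn_smul _ _).trans (h2.const_smul c)

/-- The Banach space `V_q`, the closure of `𝒱` in `W^{1,q}(Ω)^d`, with the norm of `L^q × L^q`. An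
element is a field together with its weak gradient: a limit of `(φ_n, ∇φ_n)` in `L^q × L^q` is a
pair `(u, ∇u)`. -/
def V (Ω : Set (Vec d)) (q : ℝ≥0∞) [Fact (1 ≤ q)] : Type :=
  (solenoidalGraph Ω q).topologicalClosure

instance (Ω : Set (Vec d)) (q : ℝ≥0∞) [Fact (1 ≤ q)] : NormedAddCommGroup (V Ω q) :=
  inferInstanceAs (NormedAddCommGroup (solenoidalGraph Ω q).topologicalClosure)

instance (Ω : Set (Vec d)) (q : ℝ≥0∞) [Fact (1 ≤ q)] : NormedSpace ℝ (V Ω q) :=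
  inferInstanceAs (NormedSpace ℝ (solenoidalGraph Ω q).topologicalClosure)

instance (Ω : Set (Vec d)) (q : ℝ≥0∞) [Fact (1 ≤ q)] : CompleteSpace (V Ω q) :=
  inferInstanceAs (CompleteSpace (solenoidalGraph Ω q).topologicalClosure)

/-- The inclusion of `V_q` into `L^q(Ω)^d × L^q(Ω)^{d×d}`, `u ↦ (u, ∇u)`. -/
def toPair {Ω : Set (Vec d)} {q : ℝ≥0∞} [Fact (1 ≤ q)] (u : V Ω q) :
    Lp (Vec d) q (volume.restrict Ω) × Lp (Mat d) q (volume.restrict Ω) :=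
  Subtype.val u

section accessors

variable {Ω : Set (Vec d)} {q : ℝ≥0∞} [Fact (1 ≤ q)]

/-- The field `u` underlying an element of `V_q`. -/
def fld (u : V Ω q) : Vec d → Vec d := (toPair u).1

/-- The weak gradient `∇u` of an element of `V_q`. -/
def wgrad (u : V Ω q) : Vec d → Mat d := (toPair u).2

/-- The symmetric gradient `D(u)` of an element of `V_q`. -/
def symGrad (u : V Ω q) (x : Vec d) : Mat d := symPart (wgrad u x)

end accessors

/-- `u ∈ V_q` and `w ∈ V_r` are the same element of `W^{1,1}(Ω)^d`. -/
def SameField {Ω : Set (Vec d)} {q r : ℝ≥0∞} [Fact (1 ≤ q)] [Fact (1 ≤ r)]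
    (u : V Ω q) (w : V Ω r) : Prop :=
  fld u =ᵐ[volume.restrict Ω] fld w ∧ wgrad u =ᵐ[volume.restrict Ω] wgrad w

/-- Lebesgue measure on the time interval `(0, T)`. -/
abbrev timeMeasure (T : ℝ) : Measure ℝ := volume.restrict (Ioo 0 T)

/-- `g` is the distributional derivative of `v` on `(0, T)`, for functions with values in a
Banach space. -/
def IsWeakTimeDeriv {B : Type*} [NormedAddCommGroup B] [NormedSpace ℝ B]
    (T : ℝ) (v g : ℝ → B) : Prop :=
  ∀ η : ℝ → ℝ, ContDiff ℝ ∞ η → HasCompactSupport η → tsupport η ⊆ Ioo 0 T →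
    ∫ t in Ioo 0 T, deriv η t • v t = -∫ t in Ioo 0 T, η t • g t

/-- Test fields on the space-time cylinder: restrictions to `[0, T) × Ω` of smooth fields on
`ℝ × ℝ^d` with compact support in `(-∞, T) × Ω`, divergence-free in space. They need not vanish
at `t = 0`. -/
structure IsTestField (Ω : Set (Vec d)) (T : ℝ) (φ : ℝ → Vec d → Vec d) : Prop where
  smooth : ContDiff ℝ ∞ (Function.uncurry φ)
  compact : HasCompactSupport (Function.uncurry φ)
  supp : tsupport (Function.uncurry φ) ⊆ Iio T ×ˢ Ω
  div_eq_zero : ∀ t x, divergence (φ t) x = 0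

/-- The time derivative `∂_t φ`. -/
def timeDeriv (φ : ℝ → Vec d → Vec d) (t : ℝ) (x : Vec d) : Vec d := deriv (fun s => φ s x) t

/-- The weak formulation of
`∂_t (v - κ Δv) + div (v ⊗ v) + ∇π - ν div (|D(v)|^{p-2} D(v)) = f` tested with `φ`. -/
def WeakIdentity (Ω : Set (Vec d)) (T κ ν p : ℝ) (f : ℝ → Vec d → Vec d) (v₀ : V Ω 2)
    (v : ℝ → V Ω 2) (φ : ℝ → Vec d → Vec d) : Prop :=
  -(∫ t in Ioo 0 T, ∫ x in Ω, inner ℝ (fld (v t) x) (timeDeriv φ t x))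
    - κ * (∫ t in Ioo 0 T, ∫ x in Ω, inner ℝ (wgrad (v t) x) (grad (timeDeriv φ t) x))
    + ν * (∫ t in Ioo 0 T, ∫ x in Ω,
        inner ℝ (powerLaw p (symGrad (v t) x)) (symPart (grad (φ t) x)))
  = (∫ x in Ω, inner ℝ (fld v₀ x) (φ 0 x))
    + κ * (∫ x in Ω, inner ℝ (wgrad v₀ x) (grad (φ 0) x))
    + (∫ t in Ioo 0 T, ∫ x in Ω, inner ℝ (f t x) (φ t x))
    + ∫ t in Ioo 0 T, ∫ x in Ω, inner ℝ (outer (fld (v t) x) (fld (v t) x)) (grad (φ t) x)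

/-- `v` (a representative of a class of functions on `(0, T)` modulo null sets) is a weak solution
of the generalised Navier–Stokes–Voigt problem with data `f`, `v₀`.
The spaces `L^r(0, T; B)` are Bochner spaces. -/
structure IsWeakSolution (Ω : Set (Vec d)) (T κ ν p : ℝ) [Fact (1 ≤ ENNReal.ofReal p)]
    (f : ℝ → Vec d → Vec d) (v₀ : V Ω 2) (v : ℝ → V Ω 2) : Prop where
  /-- `v ∈ L^∞(0, T; V)`. -/
  memLp_top : MemLp v ∞ (timeMeasure T)
  /-- `v ∈ L^p(0, T; V_p)`. -/
  memLp_p : ∃ w : ℝ → V Ω (ENNReal.ofReal p), MemLp w (ENNReal.ofReal p) (timeMeasure T) ∧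
    ∀ᵐ t ∂timeMeasure T, SameField (v t) (w t)
  /-- `∂_t v ∈ L²(0, T; V)`. -/
  timeDeriv_memLp : ∃ g : ℝ → V Ω 2, MemLp g 2 (timeMeasure T) ∧ IsWeakTimeDeriv T v g
  /-- `v(0) = v₀` in the sense of weak continuity; the limit `t → 0+` disregards null sets of
  times, as `v` is only determined up to null sets. -/
  initial : ∀ ψ, IsSolenoidal Ω ψ →
    Tendsto (fun t => ∫ x in Ω, inner ℝ (fld (v t) x) (ψ x)) (𝓝[>] 0 ⊓ ae volume)
      (𝓝 (∫ x in Ω, inner ℝ (fld v₀ x) (ψ x)))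
  /-- The weak formulation holds for all test fields. -/
  weak : ∀ φ, IsTestField Ω T φ → WeakIdentity Ω T κ ν p f v₀ v φ

end NSV

end

/-!
Let `w = v₁ - v₂` and `g = ∂_t w ∈ L²(0, T; V)`, and let `B(u, z) = (u, z) + κ (∇u, ∇z)`
(`energyForm`), which is an equivalent inner product on `V`. The uniqueness is the energy estimate
for `w`, in four steps.

* *The equation at fixed times and the initial value.* In the difference of the two weak
  formulations, tested with `η(t) φ(x)`, the data cancel. If `η` vanishes near `0`, the
  distributional derivative can be moved onto `w`, and for almost every `t`
  `B(g, φ) + ν ∫ (S(Dv₁) - S(Dv₂)) : Dφ - ∫ (v₁ ⊗ v₁ - v₂ ⊗ v₂) : ∇φ = 0`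
  (`ae_energyForm_add_residual`). Fed back into the identity for an `η` with `η(0) ≠ 0`, this gives
  `∫ η' w = -∫ η g` for those `η` too (`integral_deriv_smul_eq_neg`), and hence
  `w(t) = ∫₀ᵗ g` almost everywhere (`ae_eq_primitive`). So the weak formulation itself
  provides the initial value `w(0) = 0` in `V`.
* *Testing with `w`.* One null set of times serves a countable family of test fields that is dense
  in `V_q`, `q = max(2, p)`. As `Ω` is bounded, `V ∩ V_p = V_q`, so the equation may be tested with
  `φ = w(t)` (`energyForm_sub_le`).
* *Estimates.* The viscous term is nonnegative by monotonicity of `S` (`inner_powerLaw_sub_nonneg`).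
  The convective one is at most `K ‖w‖²` as `v₁, v₂ ∈ L^∞(0, T; V)` and `V ⊂ L⁴` for `d ≤ 4`
  (`exists_eLpNorm_four_le`, from the Gagliardo–Nirenberg–Sobolev inequality). Thus
  `B(g, w) ≤ K ‖w‖²`.
* *Conclusion.* `B(w(t), w(t)) = 2 ∫₀ᵗ B(g, w)` by Fubini's theorem
  (`integral_bilin_primitive_add`), and Grönwall's inequality gives `w = 0`
  (`primitive_eq_zero_of_energy_le`).

Time integrals of the viscous term need the measurability of `t ↦ ∫ S(Dv(t)) : Dφ`, where `v` is
only measurable with values in `V_p`; see `aestronglyMeasurable_integral_comp`.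
-/

namespace NSV

/-! ### Functions of time with values in a Banach space -/

section Time

variable {E F G : Type*} [NormedAddCommGroup E] [NormedSpace ℝ E] [NormedAddCommGroup F]
  [NormedSpace ℝ F] [NormedAddCommGroup G] [NormedSpace ℝ G]

/-- The product rule for primitives, in integrated form. It is Fubini's theorem on the two halves
`s ≤ t` and `t < s` of the square. -/
theorem integral_bilin_primitive_add [CompleteSpace E] [CompleteSpace F] [CompleteSpace G]
    {μ : Measure ℝ} [SFinite μ] (B : E →L[ℝ] F →L[ℝ] G)
    {f : ℝ → E} {g : ℝ → F} (hf : Integrable f μ) (hg : Integrable g μ) :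
    ∫ t, B (∫ s in Iic t, f s ∂μ) (g t) ∂μ + ∫ t, B (f t) (∫ s in Iio t, g s ∂μ) ∂μ
      = B (∫ t, f t ∂μ) (∫ t, g t ∂μ) := by
  have hint : Integrable (fun z : ℝ × ℝ => B (f z.1) (g z.2)) (μ.prod μ) :=
    hf.op_fst_snd (op := fun x y => B x y) (by fun_prop) ⟨‖B‖, B.le_opNorm₂⟩ hg
  have hS : MeasurableSet {z : ℝ × ℝ | z.1 ≤ z.2} := measurableSet_le measurable_fst measurable_snd
  have hflip : ∀ (y : F) (ν : Measure ℝ), Integrable f ν →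
      ∫ s, B (f s) y ∂ν = B (∫ s, f s ∂ν) y := fun y ν h =>
    (B.flip y).integral_comp_comm h
  have h1 : ∫ z in {z : ℝ × ℝ | z.1 ≤ z.2}, B (f z.1) (g z.2) ∂(μ.prod μ)
      = ∫ t, B (∫ s in Iic t, f s ∂μ) (g t) ∂μ := by
    rw [← integral_indicator hS, integral_prod_symm _ (hint.indicator hS)]
    refine integral_congr_ae (Eventually.of_forall fun t => ?_)
    dsimp only
    rw [← hflip _ _ hf.restrict, ← integral_indicator measurableSet_Iic]
    rfl
  have h2 : ∫ z in {z : ℝ × ℝ | z.1 ≤ z.2}ᶜ, B (f z.1) (g z.2) ∂(μ.prod μ)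
      = ∫ t, B (f t) (∫ s in Iio t, g s ∂μ) ∂μ := by
    rw [← integral_indicator hS.compl, integral_prod _ (hint.indicator hS.compl)]
    refine integral_congr_ae (Eventually.of_forall fun t => ?_)
    dsimp only
    rw [← (B (f t)).integral_comp_comm hg.restrict, ← integral_indicator measurableSet_Iio]
    refine integral_congr_ae (Eventually.of_forall fun s => ?_)
    simp [indicator]
  rw [← h1, ← h2, ← integral_prod_bilin B hf hg, integral_add_compl hS hint]

theorem continuous_primitive {μ : Measure ℝ} [NullSingletonClass μ] {g : ℝ → E}
    (hg : Integrable g μ) : Continuous fun t => ∫ s in Iic t, g s ∂μ := by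
  have : (fun t => ∫ s in Iic t, g s ∂μ)
      = fun t => (∫ s in Iic 0, g s ∂μ) + ∫ s in (0:ℝ)..t, g s ∂μ := by
    funext t
    rw [← intervalIntegral.integral_Iic_sub_Iic hg.integrableOn hg.integrableOn]
    abel
  rw [this]
  exact continuous_const.add
    (intervalIntegral.continuous_primitive (fun a b => hg.intervalIntegrable) 0)

theorem integrable_smul_of_continuous {T : ℝ} {c : ℝ → ℝ} (hc : Continuous c) {u : ℝ → E}
    (hu : Integrable u (timeMeasure T)) : Integrable (fun t => c t • u t) (timeMeasure T) := by
  obtain ⟨M, hM⟩ := isCompact_Icc.exists_bound_of_continuousOn (s := Icc 0 T) hc.continuousOn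
  refine hu.bdd_smul M hc.aestronglyMeasurable ?_
  filter_upwards [ae_restrict_mem measurableSet_Ioo] with t ht
    using hM t (Ioo_subset_Icc_self ht)

/-- If `w' = g` weakly on `(0, T)`, tested with functions that need not vanish at `0`, then `w` is
the primitive of `g` that vanishes at `0`. -/
theorem ae_eq_primitive [CompleteSpace E] {T : ℝ} {w g : ℝ → E}
    (hw : Integrable w (timeMeasure T)) (hg : Integrable g (timeMeasure T))
    (h : ∀ η : ℝ → ℝ, ContDiff ℝ ∞ η → HasCompactSupport η → tsupport η ⊆ Iio T →
      ∫ t in Ioo 0 T, deriv η t • w t = -∫ t in Ioo 0 T, η t • g t) :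
    ∀ᵐ t ∂timeMeasure T, w t = ∫ s in Iic t, g s ∂timeMeasure T := by
  have hWmeas : Continuous fun t => ∫ s in Iic t, g s ∂timeMeasure T := continuous_primitive hg
  have hWint : Integrable (fun t => ∫ s in Iic t, g s ∂timeMeasure T) (timeMeasure T) :=
    (hWmeas.integrableOn_Icc (a := 0) (b := T)).mono_set Ioo_subset_Icc_self
  have key : ∀ᵐ t ∂(volume : Measure ℝ), t ∈ Ioo 0 T →
      w t - ∫ s in Iic t, g s ∂timeMeasure T = 0 := by
    refine isOpen_Ioo.ae_eq_zero_of_integral_contDiff_smul_eq_zero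
      (IntegrableOn.locallyIntegrableOn (hw.sub hWint)) ?_
    intro ζ hζ hζc hζs
    obtain ⟨b, hbT, hb⟩ : ∃ b < T, ∀ t, b < t → ζ t = 0 := by
      rcases (tsupport ζ).eq_empty_or_nonempty with he | hne
      · exact ⟨T - 1, by linarith, fun t _ => image_eq_zero_of_notMem_tsupport (by simp [he])⟩
      · obtain ⟨b, hb⟩ := hζc.isCompact.exists_isGreatest hne
        exact ⟨b, (hζs hb.1).2, fun t ht =>
          image_eq_zero_of_notMem_tsupport fun hm => absurd (hb.2 hm) (not_le.2 ht)⟩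
    have hζint : ∀ a b, IntervalIntegrable ζ volume a b := fun a b =>
      hζ.continuous.intervalIntegrable a b
    set P : ℝ → ℝ := fun t => ∫ s in T..t, ζ s with hP
    have hPd : ∀ t, HasDerivAt P (ζ t) t := fun t =>
      intervalIntegral.integral_hasDerivAt_right (hζint _ _)
        (hζ.continuous.stronglyMeasurableAtFilter _ _) hζ.continuous.continuousAt
    have hPs : ContDiff ℝ ∞ P := by
      rw [contDiff_infty_iff_deriv]
      refine ⟨fun t => (hPd t).differentiableAt, ?_⟩
      rwa [show deriv P = ζ from funext fun t => (hPd t).deriv]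
    have hP0 : ∀ t, b < t → P t = 0 := by
      intro t ht
      rw [hP]
      refine intervalIntegral.integral_zero_ae (Eventually.of_forall fun s hs => hb s ?_)
      rcases le_total T t with h' | h'
      · rw [uIoc_of_le h'] at hs; linarith [hs.1]
      · rw [uIoc_of_ge h'] at hs; linarith [hs.1]
    -- The primitive of `ζ` vanishing near `T`, cut off to the left of `0`.
    set η : ℝ → ℝ := fun t => Real.smoothTransition (t + 1) * P t with hη
    have hηs : ContDiff ℝ ∞ η :=
      (Real.smoothTransition.contDiff.comp (contDiff_id.add contDiff_const)).mul hPs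
    have hsupp : Function.support η ⊆ Icc (-1) b := by
      intro t ht
      constructor
      · by_contra hlt
        exact ht (by
          simp [hη, Real.smoothTransition.zero_of_nonpos (x := t + 1) (by linarith [not_le.1 hlt])])
      · by_contra hlt
        exact ht (by simp [hη, hP0 t (not_le.1 hlt)])
    have hts : tsupport η ⊆ Icc (-1) b := closure_minimal hsupp isClosed_Icc
    have hηP : ∀ t, 0 < t → η t = P t := fun t ht => by
      simp [hη, Real.smoothTransition.one_of_one_le (x := t + 1) (by linarith)]
    have hηd : ∀ t, 0 < t → deriv η t = ζ t := fun t ht => by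
      have : η =ᶠ[𝓝 t] P := by
        filter_upwards [lt_mem_nhds ht] with s hs using hηP s hs
      rw [this.deriv_eq, (hPd t).deriv]
    have hmain := h η hηs (HasCompactSupport.of_support_subset_isCompact isCompact_Icc hsupp)
      (hts.trans fun t ht => lt_of_le_of_lt ht.2 hbT)
    have hζI : Integrable ζ (timeMeasure T) :=
      (hζ.continuous.integrable_of_hasCompactSupport hζc).restrict
    have hprod := integral_bilin_primitive_add (μ := timeMeasure T)
      (ContinuousLinearMap.lsmul ℝ ℝ : ℝ →L[ℝ] E →L[ℝ] E).flip hg hζI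
    simp only [ContinuousLinearMap.flip_apply, ContinuousLinearMap.lsmul_apply] at hprod
    have hA : ∀ t ∈ Ioo 0 T, ∫ s in Iio t, ζ s ∂timeMeasure T
        = P t + ∫ s, ζ s ∂timeMeasure T := by
      intro t ht
      have e1 : ∫ s in Iio t, ζ s ∂timeMeasure T = ∫ s in (0:ℝ)..t, ζ s := by
        rw [intervalIntegral.integral_of_le ht.1.le, integral_Ioc_eq_integral_Ioo,
          Measure.restrict_restrict measurableSet_Iio]
        congr 2
        ext s; simp only [mem_inter_iff, mem_Iio, mem_Ioo]
        constructor
        · rintro ⟨a, b, c⟩; exact ⟨b, a⟩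
        · rintro ⟨a, b⟩; exact ⟨b, a, b.trans ht.2⟩
      have e2 : ∫ s, ζ s ∂timeMeasure T = ∫ s in (0:ℝ)..T, ζ s := by
        rw [intervalIntegral.integral_of_le (ht.1.trans ht.2).le, integral_Ioc_eq_integral_Ioo]
      rw [e1, e2, add_comm]
      exact (intervalIntegral.integral_add_adjacent_intervals (hζint _ _) (hζint _ _)).symm
    have h4 : ∫ t in Ioo 0 T, (∫ s in Iio t, ζ s ∂timeMeasure T) • g t
        = (∫ t in Ioo 0 T, η t • g t) + (∫ s, ζ s ∂timeMeasure T) • ∫ t, g t ∂timeMeasure T := by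
      rw [← integral_smul, ← integral_add (integrable_smul_of_continuous hηs.continuous hg)
        (show Integrable (fun t => (∫ s, ζ s ∂timeMeasure T) • g t) _ from hg.smul _)]
      refine setIntegral_congr_fun measurableSet_Ioo fun t ht => ?_
      simp only [hA t ht, hηP t ht.1, add_smul]
    have h5 : ∫ t in Ioo 0 T, deriv η t • w t = ∫ t in Ioo 0 T, ζ t • w t :=
      setIntegral_congr_fun measurableSet_Ioo fun t ht => by simp only [hηd t ht.1]
    have h6 : ∫ t in Ioo 0 T, ζ t • (w t - ∫ s in Iic t, g s ∂timeMeasure T) = 0 := by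
      simp only [smul_sub]
      rw [integral_sub (integrable_smul_of_continuous hζ.continuous hw)
        (integrable_smul_of_continuous hζ.continuous hWint)]
      rw [h4] at hprod
      rw [h5] at hmain
      rw [hmain]
      have : ∫ t in Ioo 0 T, ζ t • ∫ s in Iic t, g s ∂timeMeasure T
          = - ∫ t in Ioo 0 T, η t • g t := by
        rw [← add_eq_zero_iff_eq_neg]
        have := hprod
        rwa [← add_assoc, add_eq_right] at this
      rw [this, sub_self]
    rw [← h6, setIntegral_eq_integral_of_forall_compl_eq_zero]
    intro t ht
    rw [image_eq_zero_of_notMem_tsupport fun hm => ht (hζs hm), zero_smul]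
  filter_upwards [(ae_restrict_iff' measurableSet_Ioo).2 key] with t ht using sub_eq_zero.1 ht

/-- An energy estimate `⟨w', w⟩ ≤ K ‖w‖²` with `w(0) = 0` forces `w = 0`, for the pairing given by
a symmetric coercive bilinear form. -/
theorem primitive_eq_zero_of_energy_le [CompleteSpace E] {T : ℝ} (B : E →L[ℝ] E →L[ℝ] ℝ)
    (hsymm : ∀ x y, B x y = B y x) {c : ℝ} (hc : 0 < c) (hcoer : ∀ x, c * ‖x‖ ^ 2 ≤ B x x)
    {g : ℝ → E} (hg : Integrable g (timeMeasure T)) {K : ℝ} (hK : 0 ≤ K)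
    (h : ∀ᵐ t ∂timeMeasure T, B (g t) (∫ s in Iic t, g s ∂timeMeasure T)
      ≤ K * ‖∫ s in Iic t, g s ∂timeMeasure T‖ ^ 2) :
    ∀ t ∈ Ioo 0 T, ∫ s in Iic t, g s ∂timeMeasure T = 0 := by
  set W : ℝ → E := fun t => ∫ s in Iic t, g s ∂timeMeasure T with hW
  have hWc : Continuous W := continuous_primitive hg
  set y : ℝ → ℝ := fun t => B (W t) (W t) with hy
  have hyc : Continuous y := by fun_prop
  have hy0 : ∀ t, 0 ≤ y t := fun t => (by positivity : 0 ≤ c * ‖W t‖ ^ 2).trans (hcoer _)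
  have hWbd : ∀ t, ‖W t‖ ≤ ∫ s, ‖g s‖ ∂timeMeasure T := fun t =>
    (norm_integral_le_integral_norm _).trans
      (setIntegral_le_integral hg.norm (Eventually.of_forall fun _ => norm_nonneg _))
  have hBi : Integrable (fun s => B (g s) (W s)) (timeMeasure T) := by
    refine Integrable.mono' (hg.norm.const_mul (‖B‖ * ∫ s, ‖g s‖ ∂timeMeasure T)) ?_
      (Eventually.of_forall fun s => ?_)
    · exact (B.aestronglyMeasurable_comp₂ hg.aestronglyMeasurable hWc.aestronglyMeasurable)
    · calc ‖B (g s) (W s)‖ ≤ ‖B‖ * ‖g s‖ * ‖W s‖ := B.le_opNorm₂ _ _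
        _ ≤ ‖B‖ * ‖g s‖ * ∫ s, ‖g s‖ ∂timeMeasure T := by gcongr; exact hWbd s
        _ = _ := by ring
  have henergy : ∀ t, y t = 2 * ∫ s in Iic t, B (g s) (W s) ∂timeMeasure T := by
    intro t
    have hp := integral_bilin_primitive_add (μ := (timeMeasure T).restrict (Iic t)) B
      hg.restrict hg.restrict
    have hsub : ∀ s ∈ Iic t, ((timeMeasure T).restrict (Iic t)).restrict (Iic s)
        = (timeMeasure T).restrict (Iic s) := fun s hs => by
      rw [Measure.restrict_restrict measurableSet_Iic, inter_eq_left.2 (Iic_subset_Iic.2 hs)]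
    have e1 : ∫ s in Iic t, B (∫ r in Iic s, g r ∂((timeMeasure T).restrict (Iic t))) (g s)
        ∂timeMeasure T = ∫ s in Iic t, B (g s) (W s) ∂timeMeasure T :=
      setIntegral_congr_fun measurableSet_Iic fun s hs => by
        simp only [hsub s hs, hW]; rw [hsymm]
    have e2 : ∫ s in Iic t, B (g s) (∫ r in Iio s, g r ∂((timeMeasure T).restrict (Iic t)))
        ∂timeMeasure T = ∫ s in Iic t, B (g s) (W s) ∂timeMeasure T :=
      setIntegral_congr_fun measurableSet_Iic fun s hs => by
        simp only [hW]; rw [← integral_Iic_eq_integral_Iio, hsub s hs]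
    rw [e1, e2] at hp
    rw [two_mul, hp]
  have hyi : Integrable y (timeMeasure T) :=
    (hyc.integrableOn_Icc (a := 0) (b := T)).mono_set Ioo_subset_Icc_self
  set Y : ℝ → ℝ := fun t => ∫ s in (0:ℝ)..t, y s with hY
  have hYd : ∀ t, HasDerivAt Y (y t) t := fun t => hyc.integral_hasStrictDerivAt 0 t |>.hasDerivAt
  have hle : ∀ t ∈ Ico 0 T, y t ≤ 2 * K / c * Y t := by
    intro t ht
    have e : ∫ s in Iic t, y s ∂timeMeasure T = Y t := by
      rw [hY]
      simp only
      rw [intervalIntegral.integral_of_le ht.1, Measure.restrict_restrict measurableSet_Iic]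
      congr 2
      ext s; simp only [mem_inter_iff, mem_Iic, mem_Ioo, mem_Ioc]
      constructor
      · rintro ⟨a, b, c⟩; exact ⟨b, a⟩
      · rintro ⟨a, b⟩; exact ⟨b, a, b.trans_lt ht.2⟩
    rw [← e, henergy t, ← integral_const_mul, ← integral_const_mul]
    refine integral_mono_ae (hBi.restrict.const_mul _) (hyi.restrict.const_mul _) ?_
    filter_upwards [ae_restrict_of_ae h] with s hs
    have h1 := hcoer (W s)
    calc 2 * B (g s) (W s) ≤ 2 * (K * ‖W s‖ ^ 2) := by gcongr
      _ = 2 * K / c * (c * ‖W s‖ ^ 2) := by field_simp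
      _ ≤ 2 * K / c * y s := by gcongr
  have hzero := eq_zero_of_abs_deriv_le_mul_abs_self_of_eq_zero_right (f := Y) (f' := y)
    (K := 2 * K / c) (a := 0) (b := T) (fun t _ => (hYd t).continuousAt.continuousWithinAt)
    (fun t _ => (hYd t).hasDerivWithinAt) (by simp [hY]) (fun t ht => by
      have hYn : 0 ≤ Y t := intervalIntegral.integral_nonneg ht.1 fun s _ => hy0 s
      rw [Real.norm_of_nonneg (hy0 t), Real.norm_of_nonneg hYn]
      exact hle t ht)
  intro t ht
  have h1 := hle t ⟨ht.1.le, ht.2⟩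
  rw [hzero t ⟨ht.1.le, ht.2.le⟩, mul_zero] at h1
  have h2 : c * ‖W t‖ ^ 2 ≤ 0 := (hcoer _).trans h1
  have h3 : ‖W t‖ ^ 2 ≤ 0 := nonpos_of_mul_nonpos_right h2 hc
  exact norm_eq_zero.1 (pow_eq_zero_iff two_ne_zero |>.1 (le_antisymm h3 (by positivity)))

end Time

/-! ### Tensor algebra and the power law -/

section Tensor

variable {d : ℕ}

theorem inner_mat (A B : Mat d) : inner ℝ A B = ∑ i, ∑ j, A (i, j) * B (i, j) := by
  rw [PiLp.inner_apply, Fintype.sum_prod_type]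
  simp [mul_comm]

theorem symPart_add (A B : Mat d) : symPart (A + B) = symPart A + symPart B := by
  ext ij; simp [symPart]; ring

theorem symPart_smul (c : ℝ) (A : Mat d) : symPart (c • A) = c • symPart A := by
  ext ij; simp [symPart]; ring

/-- `A ↦ (A + Aᵀ) / 2` as a continuous linear map. -/
noncomputable def symPartL (d : ℕ) : Mat d →L[ℝ] Mat d :=
  LinearMap.toContinuousLinearMap
    { toFun := symPart, map_add' := symPart_add, map_smul' := symPart_smul }

theorem norm_symPart_le (A : Mat d) : ‖symPart A‖ ≤ ‖symPartL d‖ * ‖A‖ := (symPartL d).le_opNorm A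

theorem symPart_sub (A B : Mat d) : symPart (A - B) = symPart A - symPart B :=
  (symPartL d).map_sub A B

theorem norm_outer (u w : Vec d) : ‖outer u w‖ = ‖u‖ * ‖w‖ := by
  have h : ‖outer u w‖ ^ 2 = (‖u‖ * ‖w‖) ^ 2 := by
    rw [mul_pow, EuclideanSpace.real_norm_sq_eq, EuclideanSpace.real_norm_sq_eq,
      EuclideanSpace.real_norm_sq_eq, Fintype.sum_prod_type, Finset.sum_mul_sum]
    simp [outer, mul_pow]
  exact (sq_eq_sq₀ (norm_nonneg _) (by positivity)).1 h

theorem outer_self_sub_outer_self (u w : Vec d) :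
    outer u u - outer w w = outer u (u - w) + outer (u - w) w := by
  ext ij; simp [outer]; ring

theorem continuous_outer : Continuous fun z : Vec d × Vec d => outer z.1 z.2 := by
  unfold outer; fun_prop

variable {p : ℝ}

theorem norm_powerLaw (hp : 1 < p) (A : Mat d) : ‖powerLaw p A‖ = ‖A‖ ^ (p - 1) := by
  rw [powerLaw, norm_smul, Real.norm_of_nonneg (by positivity)]
  rcases eq_or_lt_of_le (norm_nonneg A) with h | h
  · rw [← h, mul_zero, Real.zero_rpow (by linarith)]
  · conv_lhs => rw [← Real.rpow_add_one h.ne']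
    congr 1; ring

theorem continuous_powerLaw (hp : 1 < p) : Continuous (powerLaw p : Mat d → Mat d) := by
  rw [continuous_iff_continuousAt]
  intro A
  by_cases hA : A = 0
  · subst hA
    rw [ContinuousAt, show powerLaw p (0 : Mat d) = 0 by simp [powerLaw],
      tendsto_zero_iff_norm_tendsto_zero]
    simp only [norm_powerLaw hp]
    have : Continuous fun A : Mat d => ‖A‖ ^ (p - 1) :=
      continuous_norm.rpow_const fun _ => Or.inr (by linarith)
    have h := this.tendsto 0
    rwa [norm_zero, Real.zero_rpow (by linarith)] at h
  · unfold powerLaw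
    exact ((continuousAt_id.norm).rpow_const (Or.inl (norm_ne_zero_iff.2 hA))).smul continuousAt_id

/-- Monotonicity of the stress. By Cauchy–Schwarz it reduces to that of `r ↦ r ^ (p - 1)`. -/
theorem inner_powerLaw_sub_nonneg (hp : 1 < p) (A B : Mat d) :
    0 ≤ inner ℝ (powerLaw p A - powerLaw p B) (A - B) := by
  have key : ∀ r : ℝ, 0 ≤ r → r ^ (p - 2) * r = r ^ (p - 1) := by
    intro r hr
    rcases eq_or_lt_of_le hr with h | h
    · rw [← h, mul_zero, Real.zero_rpow (by linarith)]
    · conv_lhs => rw [← Real.rpow_add_one h.ne']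
      congr 1; ring
  have hAB := real_inner_le_norm A B
  set a := ‖A‖
  set b := ‖B‖
  have ha : 0 ≤ a := norm_nonneg A
  have hb : 0 ≤ b := norm_nonneg B
  have h1 : inner ℝ (powerLaw p A - powerLaw p B) (A - B)
      = a ^ (p - 2) * a ^ 2 + b ^ (p - 2) * b ^ 2
        - (a ^ (p - 2) + b ^ (p - 2)) * inner ℝ A B := by
    simp only [powerLaw, inner_sub_left, inner_sub_right, real_inner_smul_left,
      real_inner_self_eq_norm_sq, real_inner_comm B A]
    ring
  have h2 : 0 ≤ (a ^ (p - 1) - b ^ (p - 1)) * (a - b) := by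
    rcases le_total a b with h | h
    · exact mul_nonneg_of_nonpos_of_nonpos
        (sub_nonpos.2 (Real.rpow_le_rpow ha h (by linarith))) (sub_nonpos.2 h)
    · exact mul_nonneg
        (sub_nonneg.2 (Real.rpow_le_rpow hb h (by linarith))) (sub_nonneg.2 h)
  rw [← key a ha, ← key b hb] at h2
  have h3 : (a ^ (p - 2) + b ^ (p - 2)) * inner ℝ A B ≤ (a ^ (p - 2) + b ^ (p - 2)) * (a * b) := by
    gcongr
  rw [h1]
  nlinarith

/-- The contraction of symmetric with arbitrary tensors only sees the symmetric part. -/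
theorem inner_symPart_symPart (A B : Mat d) :
    inner ℝ (symPart A) (symPart B) = inner ℝ (symPart A) B := by
  have h : ∀ C : Mat d, inner ℝ (symPart A) C
      = ∑ i, ∑ j, (A (i, j) + A (j, i)) / 2 * C (i, j) := fun C => by simp [inner_mat, symPart]
  have h2 : ∑ i, ∑ j, (A (i, j) + A (j, i)) / 2 * B (j, i)
      = ∑ i, ∑ j, (A (i, j) + A (j, i)) / 2 * B (i, j) := by
    rw [Finset.sum_comm]; simp only [add_comm]
  rw [h, h]
  have : ∑ i, ∑ j, (A (i, j) + A (j, i)) / 2 * symPart B (i, j)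
      = (∑ i, ∑ j, (A (i, j) + A (j, i)) / 2 * B (i, j)
        + ∑ i, ∑ j, (A (i, j) + A (j, i)) / 2 * B (j, i)) / 2 := by
    rw [← Finset.sum_add_distrib, Finset.sum_div]
    refine Finset.sum_congr rfl fun i _ => ?_
    rw [← Finset.sum_add_distrib, Finset.sum_div]
    refine Finset.sum_congr rfl fun j _ => ?_
    simp [symPart]; ring
  rw [this, h2]; ring

end Tensor

/-! ### The spaces `V_q` -/

section Spaces

variable {d : ℕ} {Ω : Set (Vec d)} {q : ℝ≥0∞} [Fact (1 ≤ q)]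

/-- The inclusion `u ↦ (u, ∇u)` as a continuous linear map. -/
noncomputable def toPairL (Ω : Set (Vec d)) (q : ℝ≥0∞) [Fact (1 ≤ q)] :
    V Ω q →L[ℝ] Lp (Vec d) q (volume.restrict Ω) × Lp (Mat d) q (volume.restrict Ω) :=
  Submodule.subtypeL (solenoidalGraph Ω q).topologicalClosure

theorem norm_toPair (u : V Ω q) : ‖toPair u‖ = ‖u‖ := rfl

theorem toPair_sub (u w : V Ω q) : toPair (u - w) = toPair u - toPair w := (toPairL Ω q).map_sub u w

theorem fld_sub (u w : V Ω q) : fld (u - w) =ᵐ[volume.restrict Ω] fld u - fld w := by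
  rw [fld, toPair_sub]; exact Lp.coeFn_sub _ _

theorem wgrad_sub (u w : V Ω q) : wgrad (u - w) =ᵐ[volume.restrict Ω] wgrad u - wgrad w := by
  rw [wgrad, toPair_sub]; exact Lp.coeFn_sub _ _

theorem memLp_fld (u : V Ω q) : MemLp (fld u) q (volume.restrict Ω) := Lp.memLp _

theorem memLp_wgrad (u : V Ω q) : MemLp (wgrad u) q (volume.restrict Ω) := Lp.memLp _

theorem eLpNorm_fld_le (u : V Ω q) :
    eLpNorm (fld u) q (volume.restrict Ω) ≤ ENNReal.ofReal ‖u‖ := by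
  rw [fld, ← Lp.enorm_def, ← ofReal_norm, ← norm_toPair]
  exact ENNReal.ofReal_le_ofReal (norm_fst_le _)

theorem eLpNorm_wgrad_le (u : V Ω q) :
    eLpNorm (wgrad u) q (volume.restrict Ω) ≤ ENNReal.ofReal ‖u‖ := by
  rw [wgrad, ← Lp.enorm_def, ← ofReal_norm, ← norm_toPair]
  exact ENNReal.ofReal_le_ofReal (norm_snd_le _)

theorem continuous_grad {φ : Vec d → Vec d} (hφ : ContDiff ℝ ∞ φ) : Continuous (grad φ) := by
  have : Continuous (fderiv ℝ φ) := hφ.continuous_fderiv (by simp)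
  unfold grad
  fun_prop

theorem hasCompactSupport_grad {φ : Vec d → Vec d} (hφ : HasCompactSupport φ) :
    HasCompactSupport (grad φ) := by
  refine (hφ.fderiv (𝕜 := ℝ)).mono fun x hx => ?_
  contrapose! hx
  simp only [Function.mem_support, not_not] at hx ⊢
  ext ij; simp [grad, hx]

theorem IsSolenoidal.memLp {φ : Vec d → Vec d} (hφ : IsSolenoidal Ω φ) (r : ℝ≥0∞) :
    MemLp φ r (volume.restrict Ω) :=
  (hφ.smooth.continuous.memLp_of_hasCompactSupport hφ.compact).restrict _

theorem IsSolenoidal.memLp_grad {φ : Vec d → Vec d} (hφ : IsSolenoidal Ω φ) (r : ℝ≥0∞) :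
    MemLp (grad φ) r (volume.restrict Ω) :=
  ((continuous_grad hφ.smooth).memLp_of_hasCompactSupport
    (hasCompactSupport_grad hφ.compact)).restrict _

variable (q) in
/-- The element of `V_q` given by a solenoidal test field. -/
noncomputable def IsSolenoidal.toV {φ : Vec d → Vec d} (hφ : IsSolenoidal Ω φ) : V Ω q :=
  ⟨((hφ.memLp q).toLp φ, (hφ.memLp_grad q).toLp (grad φ)),
    subset_closure ⟨φ, hφ, (hφ.memLp q).coeFn_toLp, (hφ.memLp_grad q).coeFn_toLp⟩⟩

theorem IsSolenoidal.fld_toV {φ : Vec d → Vec d} (hφ : IsSolenoidal Ω φ) :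
    fld (hφ.toV q) =ᵐ[volume.restrict Ω] φ := (hφ.memLp q).coeFn_toLp

theorem IsSolenoidal.wgrad_toV {φ : Vec d → Vec d} (hφ : IsSolenoidal Ω φ) :
    wgrad (hφ.toV q) =ᵐ[volume.restrict Ω] grad φ :=
  (hφ.memLp_grad q).coeFn_toLp

/-- Test fields are dense, and countably many of them suffice as `L^q` is separable. -/
theorem exists_countable_dense_solenoidal (hq : q ≠ ⊤) :
    ∃ D : Set (Vec d → Vec d), D.Countable ∧ (∀ φ ∈ D, IsSolenoidal Ω φ) ∧
      ∀ (u : V Ω q) (ε : ℝ), 0 < ε → ∃ φ ∈ D, ∃ hφ : IsSolenoidal Ω φ, ‖u - hφ.toV q‖ < ε := by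
  have : Fact (q ≠ ⊤) := ⟨hq⟩
  have hV : SecondCountableTopology (Lp (Vec d) q (volume.restrict Ω)) := inferInstance
  have hM : SecondCountableTopology (Lp (Mat d) q (volume.restrict Ω)) := inferInstance
  have hsep := TopologicalSpace.IsSeparable.of_separableSpace (solenoidalGraph Ω q : Set
    (Lp (Vec d) q (volume.restrict Ω) × Lp (Mat d) q (volume.restrict Ω)))
  obtain ⟨c, hcs, hcc, hcd⟩ := hsep.exists_countable_dense_subset
  have hch : ∀ w ∈ c, ∃ φ, ∃ hφ : IsSolenoidal Ω φ, toPair (hφ.toV q) = w := by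
    intro w hw
    obtain ⟨φ, hφ, h1, h2⟩ := hcs hw
    refine ⟨φ, hφ, Prod.ext (Lp.ext ?_) (Lp.ext ?_)⟩
    · exact hφ.fld_toV.trans h1.symm
    · exact hφ.wgrad_toV.trans h2.symm
  choose! Φ hΦ using hch
  refine ⟨Φ '' c, hcc.image Φ, ?_, fun u ε hε => ?_⟩
  · rintro _ ⟨w, hw, rfl⟩; exact (hΦ w hw).1
  · have hu : toPair u ∈ closure c :=
      closure_minimal hcd isClosed_closure u.2
    obtain ⟨w, hw, hd⟩ := Metric.mem_closure_iff.1 hu ε hε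
    obtain ⟨hφ, hφw⟩ := hΦ w hw
    refine ⟨Φ w, ⟨w, hw, rfl⟩, hφ, ?_⟩
    rw [← norm_toPair, toPair_sub, hφw, ← dist_eq_norm]
    exact hd

theorem exists_solenoidal_tendsto (u : V Ω q) :
    ∃ φ : ℕ → Vec d → Vec d, ∃ hφ : ∀ n, IsSolenoidal Ω (φ n),
      Tendsto (fun n => (hφ n).toV q) atTop (𝓝 u) := by
  have hu : toPair u ∈ closure (solenoidalGraph Ω q : Set _) := u.2
  obtain ⟨w, hw, hlim⟩ := mem_closure_iff_seq_limit.1 hu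
  choose φ hφ h1 h2 using hw
  refine ⟨φ, hφ, ?_⟩
  refine tendsto_subtype_rng.2 (hlim.congr fun n => Prod.ext (Lp.ext ?_) (Lp.ext ?_))
  · exact (h1 n).trans (hφ n).fld_toV.symm
  · exact (h2 n).trans (hφ n).wgrad_toV.symm

/-- The operator norm of the derivative is controlled by the Frobenius norm of the gradient. -/
theorem norm_fderiv_le_norm_grad (φ : Vec d → Vec d) (x : Vec d) :
    ‖fderiv ℝ φ x‖ ≤ ‖grad φ x‖ := by
  refine ContinuousLinearMap.opNorm_le_bound _ (norm_nonneg _) fun y => ?_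
  have hy : fderiv ℝ φ x y = WithLp.toLp 2 fun i => ∑ j, grad φ x (i, j) * y j := by
    conv_lhs => rw [← (EuclideanSpace.basisFun (Fin d) ℝ).sum_repr y]
    ext i
    simp [grad, mul_comm]
  refine abs_le_of_sq_le_sq' ?_ (by positivity) |>.2
  rw [hy, mul_pow, EuclideanSpace.real_norm_sq_eq, EuclideanSpace.real_norm_sq_eq,
    EuclideanSpace.real_norm_sq_eq, Fintype.sum_prod_type, Finset.sum_mul]
  refine Finset.sum_le_sum fun i _ => ?_
  exact Finset.sum_mul_sq_le_sq_mul_sq Finset.univ (fun j => grad φ x (i, j)) (fun j => y j)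

/-- The embedding `V ⊂ L⁴`, which is where `d ≤ 4` enters. -/
theorem exists_eLpNorm_four_le (hd2 : 2 ≤ d) (hd4 : d ≤ 4) (hΩ : Bornology.IsBounded Ω) :
    ∃ C : ℝ, 0 ≤ C ∧ ∀ u : V Ω 2,
      eLpNorm (fld u) 4 (volume.restrict Ω) ≤ ENNReal.ofReal (C * ‖u‖) := by
  have hfin : IsFiniteMeasure (volume.restrict Ω) := ⟨by simpa using hΩ.measure_lt_top⟩
  -- For `d = 2` the exponent `2` is critical, and `4/3` takes its place.
  obtain ⟨r, hr1, hr2, hrd, hr4⟩ : ∃ r : NNReal, 1 ≤ r ∧ r ≤ 2 ∧ r < d ∧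
      ((r : ℝ)⁻¹ - (d : ℝ)⁻¹ ≤ (4 : ℝ)⁻¹) := by
    rcases eq_or_lt_of_le hd2 with h | h
    · refine ⟨4 / 3, ?_, ?_, ?_, ?_⟩
      · rw [← NNReal.coe_le_coe]; norm_num
      · rw [← NNReal.coe_le_coe]; norm_num
      · rw [← h, ← NNReal.coe_lt_coe]; norm_num
      · rw [← h]; norm_num
    · refine ⟨2, by norm_num, le_rfl, by exact_mod_cast h, ?_⟩
      have : (4 : ℝ)⁻¹ ≤ (d : ℝ)⁻¹ := by gcongr; exact_mod_cast hd4
      norm_num at this ⊢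
      linarith
  have hsm : ∃ C : NNReal, ∀ φ, IsSolenoidal Ω φ →
      eLpNorm φ 4 (volume.restrict Ω) ≤ C * eLpNorm (grad φ) 2 (volume.restrict Ω) := by
    set C1 := eLpNormLESNormFDerivOfLeConst (Vec d) (volume : Measure (Vec d)) Ω r 4
    set M : ℝ≥0∞ := (volume.restrict Ω) univ ^ (1 / (r : ℝ≥0∞).toReal - 1 / (2 : ℝ≥0∞).toReal)
    have hMtop : M ≠ ⊤ := by
      refine ENNReal.rpow_ne_top_of_nonneg ?_ (measure_ne_top _ _)
      rw [sub_nonneg]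
      simp only [ENNReal.coe_toReal, ENNReal.toReal_ofNat]
      have : (0 : ℝ) < r := by exact_mod_cast zero_lt_one.trans_le hr1
      gcongr
      exact_mod_cast hr2
    refine ⟨C1 * M.toNNReal, fun φ hφ => ?_⟩
    have hsub : Function.support φ ⊆ Ω := (subset_tsupport φ).trans hφ.supp
    have h1 := eLpNorm_le_eLpNorm_fderiv_of_le (volume : Measure (Vec d)) (u := φ) (s := Ω)
      (p := r) (q := 4) (hφ.smooth.of_le (by simp)) hsub hr1 (by simpa using hrd)
      (by simpa using hr4) hΩ
    have hsupp : Function.support (grad φ) ⊆ Ω := fun x hx => by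
      refine hφ.supp (support_fderiv_subset ℝ fun h0 => hx ?_)
      ext ij; simp [grad, h0]
    have h2 : eLpNorm (fderiv ℝ φ) r volume ≤ eLpNorm (grad φ) r (volume.restrict Ω) := by
      rw [eLpNorm_restrict_eq_of_support_subset (μ := volume) hsupp]
      exact eLpNorm_mono fun x => norm_fderiv_le_norm_grad φ x
    have h3 : eLpNorm (grad φ) r (volume.restrict Ω)
        ≤ eLpNorm (grad φ) 2 (volume.restrict Ω) * M :=
      eLpNorm_le_eLpNorm_mul_rpow_measure_univ (by exact_mod_cast hr2)
        (continuous_grad hφ.smooth).aestronglyMeasurable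
    calc eLpNorm φ 4 (volume.restrict Ω) ≤ eLpNorm φ 4 volume :=
          eLpNorm_mono_measure _ Measure.restrict_le_self
      _ ≤ C1 * eLpNorm (fderiv ℝ φ) r volume := h1
      _ ≤ C1 * (eLpNorm (grad φ) 2 (volume.restrict Ω) * M) := by gcongr; exact h2.trans h3
      _ = _ := by rw [ENNReal.coe_mul, ENNReal.coe_toNNReal hMtop]; ring
  obtain ⟨C, hC⟩ := hsm
  refine ⟨C, C.2, fun u => ?_⟩
  obtain ⟨φ, hφ, hlim⟩ := exists_solenoidal_tendsto u
  have hfst : Tendsto (fun n => (toPair ((hφ n).toV 2)).1) atTop (𝓝 (toPair u).1) :=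
    ((continuous_fst.comp (toPairL Ω 2).continuous).tendsto u).comp hlim
  obtain ⟨ns, hns, hae⟩ :=
    (tendstoInMeasure_of_tendsto_Lp hfst).exists_seq_tendsto_ae
  have hfatou := Lp.eLpNorm_lim_le_liminf_eLpNorm (p := 4)
    (fun n => Lp.aestronglyMeasurable ((toPair ((hφ (ns n)).toV 2)).1)) _ hae
  refine hfatou.trans ?_
  have hnorm : Tendsto (fun n => ENNReal.ofReal (C * ‖(hφ (ns n)).toV 2‖)) atTop
      (𝓝 (ENNReal.ofReal (C * ‖u‖))) :=
    ENNReal.tendsto_ofReal ((hlim.comp hns.tendsto_atTop).norm.const_mul _)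
  rw [← hnorm.liminf_eq]
  refine liminf_le_liminf (Eventually.of_forall fun n => ?_)
  have e1 : eLpNorm (toPair ((hφ (ns n)).toV 2)).1 4 (volume.restrict Ω)
      = eLpNorm (φ (ns n)) 4 (volume.restrict Ω) := eLpNorm_congr_ae (hφ (ns n)).fld_toV
  have e2 : eLpNorm (grad (φ (ns n))) 2 (volume.restrict Ω)
      ≤ ENNReal.ofReal ‖(hφ (ns n)).toV 2‖ := by
    rw [← eLpNorm_congr_ae ((hφ (ns n)).wgrad_toV (q := 2))]
    exact eLpNorm_wgrad_le _
  have e3 : ENNReal.ofReal (C * ‖(hφ (ns n)).toV 2‖) = C * ENNReal.ofReal ‖(hφ (ns n)).toV 2‖ := by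
    rw [ENNReal.ofReal_mul C.coe_nonneg, ENNReal.ofReal_coe_nnreal]
  rw [e1, e3]
  refine (hC _ (hφ _)).trans ?_
  gcongr

end Spaces

/-! ### Nonlinear integral functionals -/

section Functionals

/-- For an integrand `k` continuous in both variables, `w ↦ ∫ k(x, w(x)) dx` preserves strong
measurability in a parameter. The truncations of `k` define continuous functionals on `L^q`. -/
theorem aestronglyMeasurable_integral_comp {X E S : Type*} [TopologicalSpace X]
    [MeasurableSpace X] [OpensMeasurableSpace X] [SecondCountableTopology X]
    [TopologicalSpace.PseudoMetrizableSpace X]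
    [NormedAddCommGroup E] [MeasurableSpace S] {ν : Measure S} {μ : Measure X} [IsFiniteMeasure μ]
    {q : ℝ≥0∞} [Fact (1 ≤ q)] {k : X × E → ℝ} (hk : Continuous k)
    (hint : ∀ u : Lp E q μ, Integrable (fun x => k (x, u x)) μ) {w : S → Lp E q μ}
    (hw : AEStronglyMeasurable w ν) :
    AEStronglyMeasurable (fun s => ∫ x, k (x, w s x) ∂μ) ν := by
  have hmeas : ∀ {l : X × E → ℝ}, Continuous l → ∀ u : Lp E q μ,
      AEStronglyMeasurable (fun x => l (x, u x)) μ := fun hl u =>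
    hl.comp_aestronglyMeasurable
      (continuous_id.aestronglyMeasurable.prodMk (Lp.aestronglyMeasurable u))
  have hcl : ∀ n : ℕ, Continuous fun z => max (-(n : ℝ)) (min (k z) n) := fun n => by fun_prop
  have hcont : ∀ n : ℕ, Continuous fun u : Lp E q μ =>
      ∫ x, max (-(n : ℝ)) (min (k (x, u x)) n) ∂μ := by
    intro n
    refine continuous_iff_seqContinuous.2 fun u u₀ hu => ?_
    refine tendsto_of_subseq_tendsto fun ns hns => ?_
    obtain ⟨ms, hms, hae⟩ :=
      (tendstoInMeasure_of_tendsto_Lp (hu.comp hns)).exists_seq_tendsto_ae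
    refine ⟨ms, tendsto_integral_of_dominated_convergence (fun _ => (n : ℝ))
      (fun m => hmeas (hcl n) _) (integrable_const _)
      (fun m => Eventually.of_forall fun x => ?_) ?_⟩
    · rw [Real.norm_eq_abs, abs_le]
      exact ⟨le_max_left _ _, max_le (by linarith [(Nat.cast_nonneg n : (0 : ℝ) ≤ n)])
        (min_le_right _ _)⟩
    · filter_upwards [hae] with x hx
      exact ((hcl n).tendsto (x, u₀ x)).comp (tendsto_const_nhds.prodMk_nhds hx)
  refine aestronglyMeasurable_of_tendsto_ae atTop
    (fun n : ℕ => (hcont n).comp_aestronglyMeasurable hw) (Eventually.of_forall fun s => ?_)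
  refine tendsto_integral_of_dominated_convergence (fun x => ‖k (x, w s x)‖)
    (fun m => hmeas (hcl m) _) (hint _).norm (fun m => Eventually.of_forall fun x => ?_)
    (Eventually.of_forall fun x => ?_)
  · rw [Real.norm_eq_abs, Real.norm_eq_abs, abs_le]
    have hm : (0 : ℝ) ≤ m := Nat.cast_nonneg m
    constructor
    · rcases le_total 0 (k (x, w s x)) with h | h
      · exact le_max_of_le_right (le_min (by linarith [neg_nonpos.2 (abs_nonneg (k (x, w s x)))])
          (by linarith [neg_nonpos.2 (abs_nonneg (k (x, w s x)))]))
      · exact le_max_of_le_right (le_min (neg_abs_le _)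
          (by linarith [neg_nonpos.2 (abs_nonneg (k (x, w s x)))]))
    · exact max_le (by linarith [abs_nonneg (k (x, w s x))])
        ((min_le_left _ _).trans (le_abs_self _))
  · refine tendsto_atTop_of_eventually_const (i₀ := ⌈|k (x, w s x)|⌉₊) fun m hm => ?_
    have h1 : |k (x, w s x)| ≤ m := (Nat.le_ceil _).trans (by exact_mod_cast hm)
    rw [abs_le] at h1
    rw [min_eq_left h1.2, max_eq_right h1.1]

theorem integral_norm_rpow_le {X E : Type*} [MeasurableSpace X] [NormedAddCommGroup E]
    {μ : Measure X} {f : X → E} {q : ℝ≥0∞} (hq0 : q ≠ 0) (hq : q ≠ ⊤) (hf : MemLp f q μ) {c : ℝ}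
    (hc : 0 ≤ c) (h : eLpNorm f q μ ≤ ENNReal.ofReal c) :
    ∫ x, ‖f x‖ ^ q.toReal ∂μ ≤ c ^ q.toReal := by
  have hpos : 0 < q.toReal := ENNReal.toReal_pos hq0 hq
  have hI : 0 ≤ ∫ x, ‖f x‖ ^ q.toReal ∂μ := integral_nonneg fun x => by positivity
  rw [hf.eLpNorm_eq_integral_rpow_norm hq0 hq, ENNReal.ofReal_le_ofReal_iff hc] at h
  have := Real.rpow_le_rpow (by positivity) h hpos.le
  rwa [Real.rpow_inv_rpow hI hpos.ne'] at this

variable {d : ℕ} {Ω : Set (Vec d)}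

theorem memLp_powerLaw {μ : Measure (Vec d)} {p : ℝ} (hp : 1 < p) {A : Vec d → Mat d}
    (hA : MemLp A (ENNReal.ofReal p) μ) :
    MemLp (fun x => powerLaw p (A x)) (ENNReal.ofReal (p / (p - 1))) μ := by
  have hm : AEStronglyMeasurable (fun x => powerLaw p (A x)) μ :=
    (continuous_powerLaw hp).comp_aestronglyMeasurable hA.1
  rw [← memLp_norm_iff hm]
  have h := hA.norm_rpow_div (ENNReal.ofReal (p - 1))
  rw [← ENNReal.ofReal_div_of_pos (by linarith), ENNReal.toReal_ofReal (by linarith)] at h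
  simpa only [norm_powerLaw hp] using h

theorem memLp_symGrad {q : ℝ≥0∞} [Fact (1 ≤ q)] (u : V Ω q) :
    MemLp (symGrad u) q (volume.restrict Ω) :=
  (symPartL d).comp_memLp' (memLp_wgrad u)

theorem IsSolenoidal.exists_norm_grad_le {φ : Vec d → Vec d} (hφ : IsSolenoidal Ω φ) :
    ∃ M, 0 ≤ M ∧ ∀ x, ‖grad φ x‖ ≤ M := by
  obtain ⟨M, hM⟩ := (hasCompactSupport_grad hφ.compact).exists_bound_of_continuous
    (continuous_grad hφ.smooth)
  exact ⟨M, (norm_nonneg _).trans (hM 0), hM⟩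

/-- The viscous term `∫ |D(u)|^{p-2} D(u) : D(φ)`. -/
noncomputable def stressForm {q : ℝ≥0∞} [Fact (1 ≤ q)] (p : ℝ) (u : V Ω q)
    (φ : Vec d → Vec d) : ℝ :=
  ∫ x in Ω, inner ℝ (powerLaw p (symGrad u x)) (symPart (grad φ x))

/-- The convective term `∫ u ⊗ u : ∇φ`. -/
noncomputable def convForm {q : ℝ≥0∞} [Fact (1 ≤ q)] (u : V Ω q) (φ : Vec d → Vec d) : ℝ :=
  ∫ x in Ω, inner ℝ (outer (fld u x) (fld u x)) (grad φ x)

theorem SameField.stressForm_eq {q r : ℝ≥0∞} [Fact (1 ≤ q)] [Fact (1 ≤ r)] {u : V Ω q} {w : V Ω r}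
    (h : SameField u w) (p : ℝ) (φ : Vec d → Vec d) : stressForm p u φ = stressForm p w φ := by
  refine integral_congr_ae ?_
  filter_upwards [h.2] with x hx
  simp only [symGrad, hx]

theorem integrable_stress [IsFiniteMeasure (volume.restrict Ω)] {p : ℝ} (hp : 1 < p)
    {A : Vec d → Mat d} (hA : MemLp A (ENNReal.ofReal p) (volume.restrict Ω)) {φ : Vec d → Vec d}
    (hφ : IsSolenoidal Ω φ) :
    Integrable (fun x => inner ℝ (powerLaw p (A x)) (symPart (grad φ x))) (volume.restrict Ω) := by
  have h1 : Integrable (fun x => powerLaw p (A x)) (volume.restrict Ω) := by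
    refine memLp_one_iff_integrable.1 ((memLp_powerLaw hp hA).mono_exponent ?_)
    rw [← ENNReal.ofReal_one]
    exact ENNReal.ofReal_le_ofReal ((one_le_div (by linarith)).2 (by linarith))
  obtain ⟨M, hM0, hM⟩ := hφ.exists_norm_grad_le
  refine (innerSL ℝ : Mat d →L[ℝ] Mat d →L[ℝ] ℝ).integrable_of_bilin_of_bdd_right
    (‖symPartL d‖ * M) h1 ?_ (Eventually.of_forall fun x => ?_)
  · exact ((symPartL d).continuous.comp (continuous_grad hφ.smooth)).aestronglyMeasurable
  · exact (norm_symPart_le _).trans (by gcongr; exact hM x)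

theorem integrable_conv [IsFiniteMeasure (volume.restrict Ω)] {a : Vec d → Vec d}
    (ha : MemLp a 2 (volume.restrict Ω)) {φ : Vec d → Vec d} (hφ : IsSolenoidal Ω φ) :
    Integrable (fun x => inner ℝ (outer (a x) (a x)) (grad φ x)) (volume.restrict Ω) := by
  have h1 : Integrable (fun x => outer (a x) (a x)) (volume.restrict Ω) := by
    refine Integrable.mono' (ha.integrable_norm_pow two_ne_zero)
      (continuous_outer.comp_aestronglyMeasurable (ha.1.prodMk ha.1))
      (Eventually.of_forall fun x => ?_)
    rw [norm_outer, pow_two]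
  obtain ⟨M, hM0, hM⟩ := hφ.exists_norm_grad_le
  exact (innerSL ℝ : Mat d →L[ℝ] Mat d →L[ℝ] ℝ).integrable_of_bilin_of_bdd_right
    M h1 (continuous_grad hφ.smooth).aestronglyMeasurable (Eventually.of_forall hM)

/-- Integrability in time of the viscous term: `|D|^{p-1} ≤ 1 + |D|^p` and `w ∈ L^p(S; V_p)`. -/
theorem integrable_stressForm [IsFiniteMeasure (volume.restrict Ω)] {p : ℝ} (hp : 1 < p)
    [Fact (1 ≤ ENNReal.ofReal p)] {S : Type*} [MeasurableSpace S] {ν : Measure S}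
    [IsFiniteMeasure ν] {w : S → V Ω (ENNReal.ofReal p)}
    (hw : MemLp w (ENNReal.ofReal p) ν) {φ : Vec d → Vec d} (hφ : IsSolenoidal Ω φ) :
    Integrable (fun t => stressForm p (w t) φ) ν := by
  have hp0 : ENNReal.ofReal p ≠ 0 := by simp; linarith
  have hpt : (ENNReal.ofReal p).toReal = p := ENNReal.toReal_ofReal (by linarith)
  obtain ⟨M, hM0, hM⟩ := hφ.exists_norm_grad_le
  set L := ‖symPartL d‖
  have hL0 : 0 ≤ L := norm_nonneg (symPartL d)
  have hmeas : AEStronglyMeasurable (fun t => stressForm p (w t) φ) ν := by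
    refine aestronglyMeasurable_integral_comp (μ := volume.restrict Ω)
      (k := fun z : Vec d × Mat d => inner ℝ (powerLaw p (symPart z.2)) (symPart (grad φ z.1)))
      (w := fun t => (toPair (w t)).2) ?_ (fun u => ?_) ?_
    · have h1 : Continuous (symPart : Mat d → Mat d) := (symPartL d).continuous
      have h2 := continuous_powerLaw (d := d) hp
      have h3 := continuous_grad hφ.smooth
      exact (h2.comp (h1.comp continuous_snd)).inner (h1.comp (h3.comp continuous_fst))
    · exact integrable_stress hp ((symPartL d).comp_memLp' (Lp.memLp u)) hφ
    · exact (continuous_snd.comp (toPairL Ω _).continuous).comp_aestronglyMeasurable hw.1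
  have hdom : Integrable
      (fun t => L * M * ((volume.restrict Ω).real univ + L ^ p * ‖w t‖ ^ p)) ν := by
    have h1 := hw.integrable_norm_rpow hp0 ENNReal.ofReal_ne_top
    rw [hpt] at h1
    exact ((integrable_const _).add (h1.const_mul _)).const_mul _
  refine hdom.mono' hmeas (Eventually.of_forall fun t => ?_)
  have hi : Integrable (fun x => ‖wgrad (w t) x‖ ^ p) (volume.restrict Ω) := by
    have h1 := (memLp_wgrad (w t)).integrable_norm_rpow hp0 ENNReal.ofReal_ne_top
    rwa [hpt] at h1
  have hle : ∫ x in Ω, ‖wgrad (w t) x‖ ^ p ≤ ‖w t‖ ^ p := by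
    have h1 := integral_norm_rpow_le hp0 ENNReal.ofReal_ne_top (memLp_wgrad (w t)) (norm_nonneg _)
      (eLpNorm_wgrad_le (w t))
    rwa [hpt] at h1
  have hpt2 : ∀ r : ℝ, 0 ≤ r → r ^ (p - 1) ≤ 1 + r ^ p := by
    intro r hr
    rcases le_total r 1 with h | h
    · have := Real.rpow_le_one hr h (by linarith : 0 ≤ p - 1)
      have := Real.rpow_nonneg hr p
      linarith
    · have := Real.rpow_le_rpow_of_exponent_le h (by linarith : p - 1 ≤ p)
      linarith
  calc ‖stressForm p (w t) φ‖
      ≤ ∫ x in Ω, L * M * (1 + L ^ p * ‖wgrad (w t) x‖ ^ p) := by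
        refine norm_integral_le_of_norm_le
          (((integrable_const _).add (hi.const_mul _)).const_mul _)
          (Eventually.of_forall fun x => ?_)
        calc ‖inner ℝ (powerLaw p (symGrad (w t) x)) (symPart (grad φ x))‖
            ≤ ‖powerLaw p (symGrad (w t) x)‖ * ‖symPart (grad φ x)‖ := norm_inner_le_norm _ _
          _ ≤ (1 + (L * ‖wgrad (w t) x‖) ^ p) * (L * M) := by
            rw [norm_powerLaw hp]
            gcongr
            · refine (hpt2 _ (norm_nonneg _)).trans ?_
              gcongr
              exact norm_symPart_le _
            · exact (norm_symPart_le _).trans (by gcongr; exact hM x)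
          _ = _ := by rw [Real.mul_rpow hL0 (norm_nonneg _)]; ring
    _ = L * M * ((volume.restrict Ω).real univ + L ^ p * ∫ x in Ω, ‖wgrad (w t) x‖ ^ p) := by
        rw [integral_const_mul, integral_add (integrable_const _) (hi.const_mul _),
          integral_const_mul, integral_const]
        simp
    _ ≤ _ := by gcongr

theorem integrable_convForm [IsFiniteMeasure (volume.restrict Ω)] {S : Type*} [MeasurableSpace S]
    {ν : Measure S} [IsFiniteMeasure ν] {w : S → V Ω 2}
    (hw : MemLp w 2 ν) {φ : Vec d → Vec d} (hφ : IsSolenoidal Ω φ) :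
    Integrable (fun t => convForm (w t) φ) ν := by
  obtain ⟨M, hM0, hM⟩ := hφ.exists_norm_grad_le
  have hmeas : AEStronglyMeasurable (fun t => convForm (w t) φ) ν := by
    refine aestronglyMeasurable_integral_comp (μ := volume.restrict Ω)
      (k := fun z : Vec d × Vec d => inner ℝ (outer z.2 z.2) (grad φ z.1))
      (w := fun t => (toPair (w t)).1) ?_ (fun u => ?_) ?_
    · have h3 := continuous_grad hφ.smooth
      exact (continuous_outer.comp (continuous_snd.prodMk continuous_snd)).inner
        (h3.comp continuous_fst)
    · exact integrable_conv (Lp.memLp u) hφ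
    · exact (continuous_fst.comp (toPairL Ω _).continuous).comp_aestronglyMeasurable hw.1
  refine ((hw.integrable_norm_pow two_ne_zero).const_mul M).mono' hmeas
    (Eventually.of_forall fun t => ?_)
  have hle : ∫ x in Ω, ‖fld (w t) x‖ ^ 2 ≤ ‖w t‖ ^ 2 := by
    have h1 := integral_norm_rpow_le two_ne_zero ENNReal.ofNat_ne_top (memLp_fld (w t))
      (norm_nonneg _) (eLpNorm_fld_le (w t))
    simpa using h1
  calc ‖convForm (w t) φ‖ ≤ ∫ x in Ω, M * ‖fld (w t) x‖ ^ 2 := by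
        refine norm_integral_le_of_norm_le
          (((memLp_fld (w t)).integrable_norm_pow two_ne_zero).const_mul _)
          (Eventually.of_forall fun x => ?_)
        calc ‖inner ℝ (outer (fld (w t) x) (fld (w t) x)) (grad φ x)‖
            ≤ ‖outer (fld (w t) x) (fld (w t) x)‖ * ‖grad φ x‖ := norm_inner_le_norm _ _
          _ ≤ (‖fld (w t) x‖ * ‖fld (w t) x‖) * M := by
            rw [norm_outer]; gcongr; exact hM x
          _ = _ := by ring
    _ ≤ M * ‖w t‖ ^ 2 := by rw [integral_const_mul]; gcongr

/-- An identity tested with a dense set of solenoidal fields extends to `V_q`, by Hölder's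
inequality. -/
theorem pairing_eq_zero_of_dense {q q' : ℝ≥0∞} [Fact (1 ≤ q)] [hq : ENNReal.HolderConjugate q' q]
    [Fact (1 ≤ q')]
    {a : Vec d → Vec d} {b : Vec d → Mat d} (ha : MemLp a q' (volume.restrict Ω))
    (hb : MemLp b q' (volume.restrict Ω)) {D : Set (Vec d → Vec d)}
    (hD : ∀ (u : V Ω q) (ε : ℝ), 0 < ε → ∃ φ ∈ D, ∃ hφ : IsSolenoidal Ω φ, ‖u - hφ.toV q‖ < ε)
    (h : ∀ φ ∈ D, (∫ x in Ω, inner ℝ (a x) (φ x)) + ∫ x in Ω, inner ℝ (b x) (grad φ x) = 0)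
    (u : V Ω q) :
    (∫ x in Ω, inner ℝ (a x) (fld u x)) + ∫ x in Ω, inner ℝ (b x) (wgrad u x) = 0 := by
  set Λ : V Ω q →L[ℝ] ℝ :=
    ((innerSL ℝ : Vec d →L[ℝ] Vec d →L[ℝ] ℝ).lpPairing (volume.restrict Ω) q' q (ha.toLp a)).comp
      ((ContinuousLinearMap.fst ℝ _ _).comp (toPairL Ω q)) +
    ((innerSL ℝ : Mat d →L[ℝ] Mat d →L[ℝ] ℝ).lpPairing (volume.restrict Ω) q' q (hb.toLp b)).comp
      ((ContinuousLinearMap.snd ℝ _ _).comp (toPairL Ω q))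
  have hΛu : ∀ u : V Ω q, Λ u = (∫ x in Ω, inner ℝ (a x) (fld u x))
      + ∫ x in Ω, inner ℝ (b x) (wgrad u x) := by
    intro u
    have e : Λ u = (innerSL ℝ : Vec d →L[ℝ] Vec d →L[ℝ] ℝ).lpPairing (volume.restrict Ω) q' q
        (ha.toLp a) (toPair u).1 + (innerSL ℝ : Mat d →L[ℝ] Mat d →L[ℝ] ℝ).lpPairing
        (volume.restrict Ω) q' q (hb.toLp b) (toPair u).2 := rfl
    rw [e, ContinuousLinearMap.lpPairing_eq_integral, ContinuousLinearMap.lpPairing_eq_integral]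
    congr 1
    · refine integral_congr_ae ?_
      filter_upwards [ha.coeFn_toLp] with x hx
      simp only [hx]; rfl
    · refine integral_congr_ae ?_
      filter_upwards [hb.coeFn_toLp] with x hx
      simp only [hx]; rfl
  rw [← hΛu]
  have hdense : u ∈ closure {z : V Ω q | Λ z = 0} := by
    refine Metric.mem_closure_iff.2 fun ε hε => ?_
    obtain ⟨φ, hφD, hφ, hlt⟩ := hD u ε hε
    refine ⟨hφ.toV q, ?_, by rwa [dist_eq_norm]⟩
    rw [mem_ofPred_eq, hΛu, ← h φ hφD]
    congr 1
    · refine integral_congr_ae ?_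
      filter_upwards [hφ.fld_toV (q := q)] with x hx
      rw [hx]
    · refine integral_congr_ae ?_
      filter_upwards [hφ.wgrad_toV (q := q)] with x hx
      rw [hx]
  exact closure_minimal (fun z hz => hz) (isClosed_singleton.preimage Λ.continuous) hdense

theorem memLp_outer {a b : Vec d → Vec d} {μ : Measure (Vec d)} (ha : MemLp a 4 μ)
    (hb : MemLp b 4 μ) :
    MemLp (fun x => outer (a x) (b x)) 2 μ ∧
      eLpNorm (fun x => outer (a x) (b x)) 2 μ ≤ eLpNorm a 4 μ * eLpNorm b 4 μ := by
  have : ENNReal.HolderTriple 4 4 2 := by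
    refine ENNReal.HolderTriple.of_toReal ⟨?_, ?_, ?_⟩ <;> norm_num
  have hn : ∀ᵐ x ∂μ, ‖outer (a x) (b x)‖ ≤ (1 : NNReal) * ‖a x‖ * ‖b x‖ :=
    Eventually.of_forall fun x => by rw [norm_outer]; simp
  have hm : AEStronglyMeasurable (fun x => outer (a x) (b x)) μ :=
    continuous_outer.comp_aestronglyMeasurable (ha.1.prodMk hb.1)
  have h := eLpNorm_le_eLpNorm_mul_eLpNorm'_of_norm (p := 4) (q := 4) (r := 2) ha.1 hb.1 outer 1 hn
  rw [ENNReal.coe_one, one_mul] at h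
  exact ⟨⟨hm, h.trans_lt (ENNReal.mul_lt_top ha.2 hb.2)⟩, h⟩

theorem abs_integral_inner_le {E X : Type*} [NormedAddCommGroup E] [InnerProductSpace ℝ E]
    [MeasurableSpace X] {μ : Measure X} {a b : X → E} (ha : MemLp a 2 μ) (hb : MemLp b 2 μ)
    {α β : ℝ} (hα : 0 ≤ α) (hβ : 0 ≤ β)
    (h1 : eLpNorm a 2 μ ≤ ENNReal.ofReal α) (h2 : eLpNorm b 2 μ ≤ ENNReal.ofReal β) :
    |∫ x, inner ℝ (a x) (b x) ∂μ| ≤ α * β := by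
  have e : ∫ x, inner ℝ (a x) (b x) ∂μ = inner ℝ (ha.toLp a) (hb.toLp b) := by
    rw [L2.inner_def]
    refine integral_congr_ae ?_
    filter_upwards [ha.coeFn_toLp, hb.coeFn_toLp] with x hx hy
    rw [hx, hy]
  rw [e]
  refine (abs_real_inner_le_norm _ _).trans ?_
  rw [Lp.norm_toLp, Lp.norm_toLp]
  gcongr
  · exact ENNReal.toReal_le_of_le_ofReal hα h1
  · exact ENNReal.toReal_le_of_le_ofReal hβ h2

end Functionals

/-! ### The weak formulation for products `η(t) φ(x)` -/

section Weak

variable {d : ℕ} {Ω : Set (Vec d)}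

/-- The bilinear form `(u, z) + κ (∇u, ∇z)` on `V`. -/
noncomputable def energyForm (Ω : Set (Vec d)) (κ : ℝ) : V Ω 2 →L[ℝ] V Ω 2 →L[ℝ] ℝ :=
  (innerSL ℝ).bilinearComp ((ContinuousLinearMap.fst ℝ _ _).comp (toPairL Ω 2))
      ((ContinuousLinearMap.fst ℝ _ _).comp (toPairL Ω 2)) +
    κ • (innerSL ℝ).bilinearComp ((ContinuousLinearMap.snd ℝ _ _).comp (toPairL Ω 2))
      ((ContinuousLinearMap.snd ℝ _ _).comp (toPairL Ω 2))

theorem energyForm_eq_inner (κ : ℝ) (u z : V Ω 2) : energyForm Ω κ u z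
    = inner ℝ (toPair u).1 (toPair z).1 + κ * inner ℝ (toPair u).2 (toPair z).2 := rfl

theorem energyForm_apply (κ : ℝ) (u z : V Ω 2) : energyForm Ω κ u z
    = (∫ x in Ω, inner ℝ (fld u x) (fld z x)) + κ * ∫ x in Ω, inner ℝ (wgrad u x) (wgrad z x) := by
  rw [energyForm_eq_inner, L2.inner_def, L2.inner_def]
  rfl

theorem energyForm_symm (κ : ℝ) (u z : V Ω 2) : energyForm Ω κ u z = energyForm Ω κ z u := by
  simp only [energyForm_eq_inner, real_inner_comm]

theorem energyForm_coercive {κ : ℝ} (hκ : 0 < κ) (u : V Ω 2) :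
    min 1 κ * ‖u‖ ^ 2 ≤ energyForm Ω κ u u := by
  rw [energyForm_eq_inner, real_inner_self_eq_norm_sq, real_inner_self_eq_norm_sq, ← norm_toPair,
    Prod.norm_def]
  have h1 : min 1 κ ≤ 1 := min_le_left _ _
  have h2 : min 1 κ ≤ κ := min_le_right _ _
  have h3 : 0 < min 1 κ := lt_min one_pos hκ
  rcases max_choice ‖(toPair u).1‖ ‖(toPair u).2‖ with h | h <;> rw [h]
  · nlinarith [sq_nonneg ‖(toPair u).1‖, sq_nonneg ‖(toPair u).2‖]
  · nlinarith [sq_nonneg ‖(toPair u).1‖, sq_nonneg ‖(toPair u).2‖]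

theorem energyForm_toV (κ : ℝ) (u : V Ω 2) {φ : Vec d → Vec d} (hφ : IsSolenoidal Ω φ) :
    energyForm Ω κ u (hφ.toV 2)
      = (∫ x in Ω, inner ℝ (fld u x) (φ x)) + κ * ∫ x in Ω, inner ℝ (wgrad u x) (grad φ x) := by
  rw [energyForm_apply]
  congr 1
  · refine integral_congr_ae ?_
    filter_upwards [hφ.fld_toV (q := 2)] with x hx
    rw [hx]
  · congr 1
    refine integral_congr_ae ?_
    filter_upwards [hφ.wgrad_toV (q := 2)] with x hx
    rw [hx]

theorem IsSolenoidal.isTestField_mul {T : ℝ} {φ : Vec d → Vec d} (hφ : IsSolenoidal Ω φ) {η : ℝ → ℝ}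
    (hη : ContDiff ℝ ∞ η) (hηc : HasCompactSupport η) (hηs : tsupport η ⊆ Iio T) :
    IsTestField Ω T fun t x => η t • φ x := by
  have hsub : Function.support (Function.uncurry fun t x => η t • φ x)
      ⊆ tsupport η ×ˢ tsupport φ := by
    rintro ⟨t, x⟩ h
    simp only [Function.mem_support, Function.uncurry_apply_pair, ne_eq, smul_eq_zero,
      not_or] at h
    exact ⟨subset_tsupport _ h.1, subset_tsupport _ h.2⟩
  refine ⟨(hη.comp contDiff_fst).smul (hφ.smooth.comp contDiff_snd),
    HasCompactSupport.of_support_subset_isCompact (hηc.isCompact.prod hφ.compact.isCompact) hsub,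
    ?_, fun t x => (hφ.smul (η t)).div_eq_zero x⟩
  exact (closure_minimal hsub ((isClosed_tsupport _).prod (isClosed_tsupport _))).trans
    (prod_mono hηs hφ.supp)

/-- The weak formulation for the test field `η(t) φ(x)`. -/
theorem WeakIdentity.of_mul {T κ ν p : ℝ} {f : ℝ → Vec d → Vec d} {v₀ : V Ω 2} {v : ℝ → V Ω 2}
    (hv : Integrable v (timeMeasure T)) {φ : Vec d → Vec d} (hφ : IsSolenoidal Ω φ) {η : ℝ → ℝ}
    (hη : ContDiff ℝ ∞ η) (h : WeakIdentity Ω T κ ν p f v₀ v fun t x => η t • φ x) :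
    -(∫ t in Ioo 0 T, deriv η t * energyForm Ω κ (v t) (hφ.toV 2))
        + ν * ∫ t in Ioo 0 T, η t * stressForm p (v t) φ
      = η 0 * energyForm Ω κ v₀ (hφ.toV 2)
        + (∫ t in Ioo 0 T, ∫ x in Ω, inner ℝ (f t x) (η t • φ x))
        + ∫ t in Ioo 0 T, η t * convForm (v t) φ := by
  have hg : ∀ t, grad (fun x => η t • φ x) = η t • grad φ := fun t => grad_smul (η t) hφ.smooth
  have htd : ∀ t, timeDeriv (fun t x => η t • φ x) t = deriv η t • φ := by
    intro t
    funext x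
    exact deriv_smul_const ((hη.differentiable (by simp)) t) (φ x)
  have hgd : ∀ t, grad (timeDeriv (fun t x => η t • φ x) t) = deriv η t • grad φ := fun t => by
    rw [htd, grad_smul _ hφ.smooth]
  have hdη : Continuous (deriv η) := hη.continuous_deriv (by simp)
  have hi1 : Integrable (fun t => ∫ x in Ω, inner ℝ (fld (v t) x) (φ x)) (timeMeasure T) := by
    have := (energyForm Ω 0).flip (hφ.toV 2) |>.integrable_comp hv
    simpa only [ContinuousLinearMap.flip_apply, energyForm_toV, zero_mul, add_zero] using this
  have hi12 : Integrable (fun t => (∫ x in Ω, inner ℝ (fld (v t) x) (φ x))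
      + 1 * ∫ x in Ω, inner ℝ (wgrad (v t) x) (grad φ x)) (timeMeasure T) := by
    have := (energyForm Ω 1).flip (hφ.toV 2) |>.integrable_comp hv
    simpa only [ContinuousLinearMap.flip_apply, energyForm_toV] using this
  have hi2 : Integrable (fun t => ∫ x in Ω, inner ℝ (wgrad (v t) x) (grad φ x))
      (timeMeasure T) := by
    refine (hi12.sub hi1).congr (Eventually.of_forall fun t => ?_)
    simp
  unfold WeakIdentity at h
  simp only [hgd] at h
  simp only [htd, hg, Pi.smul_apply, symPart_smul, real_inner_smul_right,
    integral_const_mul] at h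
  have e1 : ∫ t in Ioo 0 T, deriv η t * energyForm Ω κ (v t) (hφ.toV 2)
      = (∫ t in Ioo 0 T, deriv η t * ∫ x in Ω, inner ℝ (fld (v t) x) (φ x))
        + κ * ∫ t in Ioo 0 T, deriv η t * ∫ x in Ω, inner ℝ (wgrad (v t) x) (grad φ x) := by
    have a1 := integrable_smul_of_continuous hdη hi1
    have a2 := integrable_smul_of_continuous hdη hi2
    simp only [smul_eq_mul] at a1 a2
    rw [← integral_const_mul, ← integral_add a1 (a2.const_mul κ)]
    refine integral_congr_ae (Eventually.of_forall fun t => ?_)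
    simp only [energyForm_toV]; ring
  rw [e1, energyForm_toV]
  unfold stressForm convForm
  simp only [real_inner_smul_right, integral_const_mul]
  linear_combination h

/-- Stress minus convection, for the difference of two velocity fields, tested with `φ`. -/
noncomputable def residual (ν p : ℝ) (u₁ u₂ : V Ω 2) (φ : Vec d → Vec d) : ℝ :=
  ν * (stressForm p u₁ φ - stressForm p u₂ φ) - (convForm u₁ φ - convForm u₂ φ)

variable {T κ ν p : ℝ} [Fact (1 ≤ ENNReal.ofReal p)]
  {f : ℝ → Vec d → Vec d} {v₀ : V Ω 2} {v v₁ v₂ : ℝ → V Ω 2}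

theorem IsWeakSolution.integrable (hv : IsWeakSolution Ω T κ ν p f v₀ v) :
    Integrable v (timeMeasure T) :=
  hv.memLp_top.integrable le_top

theorem IsWeakSolution.exists_ae_norm_le (hv : IsWeakSolution Ω T κ ν p f v₀ v) :
    ∃ R, ∀ᵐ t ∂timeMeasure T, ‖v t‖ ≤ R := by
  have hfin := hv.memLp_top.2
  rw [eLpNorm_exponent_top] at hfin
  refine ⟨(eLpNormEssSup v (timeMeasure T)).toReal, ?_⟩
  filter_upwards [enorm_ae_le_eLpNormEssSup v (timeMeasure T)] with t ht
  rw [← toReal_enorm]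
  exact ENNReal.toReal_mono hfin.ne ht

theorem IsWeakTimeDeriv.sub (hv₁ : Integrable v₁ (timeMeasure T))
    (hv₂ : Integrable v₂ (timeMeasure T)) {g₁ g₂ : ℝ → V Ω 2}
    (hi₁ : Integrable g₁ (timeMeasure T)) (hi₂ : Integrable g₂ (timeMeasure T))
    (hg₁ : IsWeakTimeDeriv T v₁ g₁)
    (hg₂ : IsWeakTimeDeriv T v₂ g₂) :
    IsWeakTimeDeriv T (fun t => v₁ t - v₂ t) fun t => g₁ t - g₂ t := by
  intro η hη hηc hηs
  have hdη : Continuous (deriv η) := hη.continuous_deriv (by simp)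
  simp only [smul_sub]
  rw [integral_sub (integrable_smul_of_continuous hdη hv₁) (integrable_smul_of_continuous hdη hv₂),
    integral_sub (integrable_smul_of_continuous hη.continuous hi₁)
      (integrable_smul_of_continuous hη.continuous hi₂), hg₁ η hη hηc hηs, hg₂ η hη hηc hηs]
  abel

variable [IsFiniteMeasure (volume.restrict Ω)]

theorem IsWeakSolution.integrable_stressForm (hp : 1 < p) (hv : IsWeakSolution Ω T κ ν p f v₀ v)
    {φ : Vec d → Vec d} (hφ : IsSolenoidal Ω φ) :
    Integrable (fun t => stressForm p (v t) φ) (timeMeasure T) := by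
  obtain ⟨w, hw, hs⟩ := hv.memLp_p
  refine (NSV.integrable_stressForm hp hw hφ).congr ?_
  filter_upwards [hs] with t ht using (ht.stressForm_eq p φ).symm

theorem IsWeakSolution.integrable_convForm (hv : IsWeakSolution Ω T κ ν p f v₀ v)
    {φ : Vec d → Vec d} (hφ : IsSolenoidal Ω φ) :
    Integrable (fun t => convForm (v t) φ) (timeMeasure T) :=
  NSV.integrable_convForm (hv.memLp_top.mono_exponent le_top) hφ

theorem integrable_residual (hp : 1 < p) (hv₁ : IsWeakSolution Ω T κ ν p f v₀ v₁)
    (hv₂ : IsWeakSolution Ω T κ ν p f v₀ v₂) {φ : Vec d → Vec d} (hφ : IsSolenoidal Ω φ) :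
    Integrable (fun t => residual ν p (v₁ t) (v₂ t) φ) (timeMeasure T) :=
  (((hv₁.integrable_stressForm hp hφ).sub (hv₂.integrable_stressForm hp hφ)).const_mul ν).sub
    ((hv₁.integrable_convForm hφ).sub (hv₂.integrable_convForm hφ))

/-- The data cancel in the difference of two weak formulations, also at the initial time. -/
theorem integral_deriv_mul_energyForm_sub (hp : 1 < p) (hv₁ : IsWeakSolution Ω T κ ν p f v₀ v₁)
    (hv₂ : IsWeakSolution Ω T κ ν p f v₀ v₂) {φ : Vec d → Vec d} (hφ : IsSolenoidal Ω φ) {η : ℝ → ℝ}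
    (hη : ContDiff ℝ ∞ η) (hηc : HasCompactSupport η) (hηs : tsupport η ⊆ Iio T) :
    ∫ t in Ioo 0 T, deriv η t * energyForm Ω κ (v₁ t - v₂ t) (hφ.toV 2)
      = ∫ t in Ioo 0 T, η t * residual ν p (v₁ t) (v₂ t) φ := by
  have htest := hφ.isTestField_mul hη hηc hηs
  have h1 := (hv₁.weak _ htest).of_mul hv₁.integrable hφ hη
  have h2 := (hv₂.weak _ htest).of_mul hv₂.integrable hφ hη
  have hdη : Continuous (deriv η) := hη.continuous_deriv (by simp)
  have hB : ∀ {v : ℝ → V Ω 2}, Integrable v (timeMeasure T) →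
      Integrable (fun t => deriv η t * energyForm Ω κ (v t) (hφ.toV 2)) (timeMeasure T) :=
    fun hv => integrable_smul_of_continuous hdη
      (((energyForm Ω κ).flip (hφ.toV 2)).integrable_comp hv)
  have e1 : ∫ t in Ioo 0 T, deriv η t * energyForm Ω κ (v₁ t - v₂ t) (hφ.toV 2)
      = (∫ t in Ioo 0 T, deriv η t * energyForm Ω κ (v₁ t) (hφ.toV 2))
        - ∫ t in Ioo 0 T, deriv η t * energyForm Ω κ (v₂ t) (hφ.toV 2) := by
    rw [← integral_sub (hB hv₁.integrable) (hB hv₂.integrable)]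
    refine integral_congr_ae (Eventually.of_forall fun t => ?_)
    simp only [map_sub, sub_apply]; ring
  have hS₁ := integrable_smul_of_continuous hη.continuous (hv₁.integrable_stressForm hp hφ)
  have hS₂ := integrable_smul_of_continuous hη.continuous (hv₂.integrable_stressForm hp hφ)
  have hC₁ := integrable_smul_of_continuous hη.continuous (hv₁.integrable_convForm hφ)
  have hC₂ := integrable_smul_of_continuous hη.continuous (hv₂.integrable_convForm hφ)
  simp only [smul_eq_mul] at hS₁ hS₂ hC₁ hC₂
  have e2 : ∫ t in Ioo 0 T, η t * residual ν p (v₁ t) (v₂ t) φ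
      = ν * ((∫ t in Ioo 0 T, η t * stressForm p (v₁ t) φ)
          - ∫ t in Ioo 0 T, η t * stressForm p (v₂ t) φ)
        - ((∫ t in Ioo 0 T, η t * convForm (v₁ t) φ)
          - ∫ t in Ioo 0 T, η t * convForm (v₂ t) φ) := by
    have hS : Integrable (fun t => η t * stressForm p (v₁ t) φ - η t * stressForm p (v₂ t) φ)
      (timeMeasure T) := hS₁.sub hS₂
    have hC : Integrable (fun t => η t * convForm (v₁ t) φ - η t * convForm (v₂ t) φ)
      (timeMeasure T) := hC₁.sub hC₂
    rw [← integral_sub hS₁ hS₂, ← integral_sub hC₁ hC₂, ← integral_const_mul,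
      ← integral_sub (hS.const_mul ν) hC]
    refine integral_congr_ae (Eventually.of_forall fun t => ?_)
    simp only [residual]; ring
  rw [e1, e2]
  linear_combination h2 - h1

/-- The equation for `v₁ - v₂` at almost every time, tested with a fixed field. -/
theorem ae_energyForm_add_residual (hp : 1 < p) (hv₁ : IsWeakSolution Ω T κ ν p f v₀ v₁)
    (hv₂ : IsWeakSolution Ω T κ ν p f v₀ v₂) {g : ℝ → V Ω 2} (hi : Integrable g (timeMeasure T))
    (hg : IsWeakTimeDeriv T (fun t => v₁ t - v₂ t) g) {φ : Vec d → Vec d} (hφ : IsSolenoidal Ω φ) :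
    ∀ᵐ t ∂timeMeasure T,
      energyForm Ω κ (g t) (hφ.toV 2) + residual ν p (v₁ t) (v₂ t) φ = 0 := by
  set Λ := (energyForm Ω κ).flip (hφ.toV 2)
  have hR := integrable_residual hp hv₁ hv₂ hφ
  have hB : Integrable (fun t => Λ (g t)) (timeMeasure T) := Λ.integrable_comp hi
  rw [ae_restrict_iff' measurableSet_Ioo]
  refine isOpen_Ioo.ae_eq_zero_of_integral_contDiff_smul_eq_zero
    (IntegrableOn.locallyIntegrableOn (hB.add hR)) fun η hη hηc hηs => ?_
  have hdη : Continuous (deriv η) := hη.continuous_deriv (by simp)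
  have h1 := integral_deriv_mul_energyForm_sub hp hv₁ hv₂ hφ hη hηc
    (hηs.trans Ioo_subset_Iio_self)
  have hw : Integrable (fun t => v₁ t - v₂ t) (timeMeasure T) := hv₁.integrable.sub hv₂.integrable
  have h2 : Λ (∫ t in Ioo 0 T, deriv η t • (v₁ t - v₂ t)) = Λ (-∫ t in Ioo 0 T, η t • g t) :=
    congrArg Λ (hg η hη hηc hηs)
  rw [map_neg, ← Λ.integral_comp_comm (integrable_smul_of_continuous hη.continuous hi),
    ← Λ.integral_comp_comm (integrable_smul_of_continuous hdη hw)] at h2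
  simp only [map_smul, smul_eq_mul] at h2
  have h3 : ∫ t in Ioo 0 T, η t • (Λ (g t) + residual ν p (v₁ t) (v₂ t) φ) = 0 := by
    simp only [smul_add]
    rw [integral_add (integrable_smul_of_continuous hη.continuous hB)
      (integrable_smul_of_continuous hη.continuous hR)]
    simp only [smul_eq_mul]
    rw [← h1]
    have h4 : ∫ t in Ioo 0 T, deriv η t * energyForm Ω κ (v₁ t - v₂ t) (hφ.toV 2)
      = ∫ t in Ioo 0 T, deriv η t * Λ (v₁ t - v₂ t) := rfl
    rw [h4, h2, add_neg_cancel]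
  rw [← h3, setIntegral_eq_integral_of_forall_compl_eq_zero]
  · rfl
  · intro t ht
    rw [image_eq_zero_of_notMem_tsupport fun hm => ht (hηs hm), zero_smul]

/-- The weak formulation improves the distributional derivative: `∂_t (v₁ - v₂) = g` also holds
against test functions that do not vanish at `0`, which encodes `v₁(0) = v₂(0)` in `V`. -/
theorem integral_deriv_smul_eq_neg (hκ : 0 < κ) (hp : 1 < p)
    (hv₁ : IsWeakSolution Ω T κ ν p f v₀ v₁)
    (hv₂ : IsWeakSolution Ω T κ ν p f v₀ v₂) {g : ℝ → V Ω 2} (hi : Integrable g (timeMeasure T))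
    (hg : IsWeakTimeDeriv T (fun t => v₁ t - v₂ t) g) {η : ℝ → ℝ}
    (hη : ContDiff ℝ ∞ η) (hηc : HasCompactSupport η) (hηs : tsupport η ⊆ Iio T) :
    ∫ t in Ioo 0 T, deriv η t • (v₁ t - v₂ t) = -∫ t in Ioo 0 T, η t • g t := by
  set X : V Ω 2 := (∫ t in Ioo 0 T, deriv η t • (v₁ t - v₂ t)) + ∫ t in Ioo 0 T, η t • g t with hX
  have hdη : Continuous (deriv η) := hη.continuous_deriv (by simp)
  have hzero : ∀ {φ : Vec d → Vec d} (hφ : IsSolenoidal Ω φ), energyForm Ω κ X (hφ.toV 2) = 0 := by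
    intro φ hφ
    set Λ := (energyForm Ω κ).flip (hφ.toV 2)
    have hw : Integrable (fun t => v₁ t - v₂ t) (timeMeasure T) :=
      hv₁.integrable.sub hv₂.integrable
    change Λ X = 0
    rw [hX, map_add, ← Λ.integral_comp_comm (integrable_smul_of_continuous hη.continuous hi),
      ← Λ.integral_comp_comm (integrable_smul_of_continuous hdη hw)]
    simp only [map_smul, smul_eq_mul]
    have h1 : ∫ t in Ioo 0 T, deriv η t * Λ (v₁ t - v₂ t)
        = ∫ t in Ioo 0 T, η t * residual ν p (v₁ t) (v₂ t) φ :=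
      integral_deriv_mul_energyForm_sub hp hv₁ hv₂ hφ hη hηc hηs
    have h2 : ∫ t in Ioo 0 T, η t * Λ (g t)
        = ∫ t in Ioo 0 T, -(η t * residual ν p (v₁ t) (v₂ t) φ) := by
      refine integral_congr_ae ?_
      filter_upwards [ae_energyForm_add_residual hp hv₁ hv₂ hi hg hφ] with t ht
      have : Λ (g t) = -residual ν p (v₁ t) (v₂ t) φ := eq_neg_of_add_eq_zero_left ht
      rw [this, mul_neg]
    rw [h1, h2, integral_neg, add_neg_cancel]
  obtain ⟨φ, hφ, hlim⟩ := exists_solenoidal_tendsto X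
  have h1 : Tendsto (fun n => energyForm Ω κ X ((hφ n).toV 2)) atTop (𝓝 (energyForm Ω κ X X)) :=
    ((energyForm Ω κ X).continuous.tendsto X).comp hlim
  simp only [hzero] at h1
  have h2 : energyForm Ω κ X X = 0 := tendsto_nhds_unique h1 tendsto_const_nhds
  have h3 := energyForm_coercive hκ X
  rw [h2] at h3
  have h4 : ‖X‖ ^ 2 ≤ 0 := nonpos_of_mul_nonpos_right h3 (lt_min one_pos hκ)
  have h5 : X = 0 :=
    norm_eq_zero.1 (pow_eq_zero_iff two_ne_zero |>.1 (le_antisymm h4 (by positivity)))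
  exact eq_neg_of_add_eq_zero_left h5

end Weak

/-! ### The energy inequality -/

section Energy

variable {d : ℕ} {Ω : Set (Vec d)}

theorem SameField.sub {q r : ℝ≥0∞} [Fact (1 ≤ q)] [Fact (1 ≤ r)] {u u' : V Ω q} {w w' : V Ω r}
    (h : SameField u w) (h' : SameField u' w') : SameField (u - u') (w - w') := by
  constructor
  · filter_upwards [h.1, h'.1, fld_sub u u', fld_sub w w'] with x h1 h2 h3 h4
    rw [h3, h4, Pi.sub_apply, Pi.sub_apply, h1, h2]
  · filter_upwards [h.2, h'.2, wgrad_sub u u', wgrad_sub w w'] with x h1 h2 h3 h4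
    rw [h3, h4, Pi.sub_apply, Pi.sub_apply, h1, h2]

theorem inner_powerLaw_symPart (p : ℝ) (A B : Mat d) :
    inner ℝ (powerLaw p (symPart A)) (symPart B) = inner ℝ (powerLaw p (symPart A)) B := by
  simp only [powerLaw, real_inner_smul_left, inner_symPart_symPart]

/-- The convective difference is `u₁ ⊗ w + w ⊗ u₂` with `w = u₁ - u₂`, estimated by Hölder's
inequality with exponents `4, 4, 2`. -/
theorem abs_integral_conv_sub_le {C R : ℝ} (hC : 0 ≤ C)
    (hsob : ∀ u : V Ω 2, eLpNorm (fld u) 4 (volume.restrict Ω) ≤ ENNReal.ofReal (C * ‖u‖))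
    {u₁ u₂ : V Ω 2} (h₁ : ‖u₁‖ ≤ R) (h₂ : ‖u₂‖ ≤ R) :
    |∫ x in Ω, inner ℝ (outer (fld u₁ x) (fld u₁ x) - outer (fld u₂ x) (fld u₂ x))
      (wgrad (u₁ - u₂) x)| ≤ 2 * C ^ 2 * R * ‖u₁ - u₂‖ ^ 2 := by
  have hR : 0 ≤ R := (norm_nonneg _).trans h₁
  have h4 : ∀ u : V Ω 2, MemLp (fld u) 4 (volume.restrict Ω) := fun u =>
    ⟨(memLp_fld u).1, (hsob u).trans_lt ENNReal.ofReal_lt_top⟩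
  set w := u₁ - u₂ with hw
  have ha := memLp_outer (h4 u₁) (h4 w)
  have hb := memLp_outer (h4 w) (h4 u₂)
  have hbound : ∀ {u z : V Ω 2}, eLpNorm (fld u) 4 (volume.restrict Ω)
      * eLpNorm (fld z) 4 (volume.restrict Ω) ≤ ENNReal.ofReal (C * ‖u‖ * (C * ‖z‖)) := by
    intro u z
    rw [ENNReal.ofReal_mul (by positivity)]
    gcongr <;> exact hsob _
  have hnorm : eLpNorm ((fun x => outer (fld u₁ x) (fld w x)) + fun x => outer (fld w x) (fld u₂ x))
      2 (volume.restrict Ω) ≤ ENNReal.ofReal (2 * C ^ 2 * R * ‖w‖) := by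
    refine (eLpNorm_add_le ha.1.1 hb.1.1 (by norm_num)).trans ?_
    refine (add_le_add (ha.2.trans hbound) (hb.2.trans hbound)).trans ?_
    rw [← ENNReal.ofReal_add (by positivity) (by positivity)]
    refine ENNReal.ofReal_le_ofReal ?_
    calc C * ‖u₁‖ * (C * ‖w‖) + C * ‖w‖ * (C * ‖u₂‖)
        ≤ C * R * (C * ‖w‖) + C * ‖w‖ * (C * R) := by gcongr
      _ = _ := by ring
  have h := abs_integral_inner_le (ha.1.add hb.1) (memLp_wgrad w) (by positivity) (norm_nonneg _)
    hnorm (eLpNorm_wgrad_le w)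
  have e : ∫ x in Ω, inner ℝ (outer (fld u₁ x) (fld u₁ x) - outer (fld u₂ x) (fld u₂ x)) (wgrad w x)
      = ∫ x in Ω, inner ℝ (((fun x => outer (fld u₁ x) (fld w x))
        + fun x => outer (fld w x) (fld u₂ x)) x) (wgrad w x) := by
    refine integral_congr_ae ?_
    filter_upwards [fld_sub u₁ u₂] with x hx
    rw [outer_self_sub_outer_self, Pi.add_apply, hw, hx, Pi.sub_apply]
  rw [e]
  refine h.trans (le_of_eq (by ring))

/-- At a fixed time, the equation tested with a dense set of fields may be tested with the
difference `u₁ - u₂` itself. The viscous term then has a sign and the convective one is quadratic.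
The exponent `q` is such that the equation extends to `V_q`. -/
theorem energyForm_sub_le [IsFiniteMeasure (volume.restrict Ω)] {κ ν p : ℝ} (hν : 0 < ν)
    (hp : 1 < p) [Fact (1 ≤ ENNReal.ofReal p)] {q q' : ℝ≥0∞} [Fact (1 ≤ q)] [Fact (1 ≤ q')]
    [ENNReal.HolderConjugate q' q] (hq2 : q' ≤ 2) (hqp : q' ≤ ENNReal.ofReal (p / (p - 1)))
    {D : Set (Vec d → Vec d)}
    (hD : ∀ (u : V Ω q) (ε : ℝ), 0 < ε → ∃ φ ∈ D, ∃ hφ : IsSolenoidal Ω φ, ‖u - hφ.toV q‖ < ε)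
    {C R : ℝ} (hC : 0 ≤ C)
    (hsob : ∀ u : V Ω 2, eLpNorm (fld u) 4 (volume.restrict Ω) ≤ ENNReal.ofReal (C * ‖u‖))
    {u₁ u₂ g : V Ω 2} {w₁ w₂ : V Ω (ENNReal.ofReal p)} (hs₁ : SameField u₁ w₁)
    (hs₂ : SameField u₂ w₂) (h₁ : ‖u₁‖ ≤ R) (h₂ : ‖u₂‖ ≤ R) {z : V Ω q}
    (hz : SameField (u₁ - u₂) z)
    (h : ∀ φ ∈ D, ∃ hφ : IsSolenoidal Ω φ,
      energyForm Ω κ g (hφ.toV 2) + residual ν p u₁ u₂ φ = 0) :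
    energyForm Ω κ g (u₁ - u₂) ≤ 2 * C ^ 2 * R * ‖u₁ - u₂‖ ^ 2 := by
  set μ := volume.restrict Ω with hμ
  have hD₁ : MemLp (symGrad u₁) (ENNReal.ofReal p) μ := by
    refine (memLp_symGrad w₁).ae_eq ?_
    filter_upwards [hs₁.2] with x hx
    simp only [symGrad, hx]
  have hD₂ : MemLp (symGrad u₂) (ENNReal.ofReal p) μ := by
    refine (memLp_symGrad w₂).ae_eq ?_
    filter_upwards [hs₂.2] with x hx
    simp only [symGrad, hx]
  have h4 : ∀ u : V Ω 2, MemLp (fld u) 4 μ := fun u =>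
    ⟨(memLp_fld u).1, (hsob u).trans_lt ENNReal.ofReal_lt_top⟩
  -- The equation reads `∫ a · φ + ∫ (κ ∇g + ν S - O) : ∇φ = 0`.
  set S : Vec d → Mat d := fun x => powerLaw p (symGrad u₁ x) - powerLaw p (symGrad u₂ x) with hS
  set O : Vec d → Mat d :=
    fun x => outer (fld u₁ x) (fld u₁ x) - outer (fld u₂ x) (fld u₂ x) with hO
  have hSm : MemLp S (ENNReal.ofReal (p / (p - 1))) μ :=
    (memLp_powerLaw hp hD₁).sub (memLp_powerLaw hp hD₂)
  have hOm : MemLp O 2 μ := (memLp_outer (h4 u₁) (h4 u₁)).1.sub (memLp_outer (h4 u₂) (h4 u₂)).1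
  set b : Vec d → Mat d := fun x => κ • wgrad g x + ν • S x - O x with hb
  have hbm : MemLp b q' μ :=
    ((((memLp_wgrad g).mono_exponent hq2).const_smul κ).add
      ((hSm.mono_exponent hqp).const_smul ν)).sub (hOm.mono_exponent hq2)
  -- Splitting `∫ b : G`, for `G = ∇φ` and `G = ∇(u₁ - u₂)`.
  have hsplit : ∀ {G : Vec d → Mat d}, MemLp G 2 μ → MemLp G (ENNReal.ofReal p) μ →
      ∫ x, inner ℝ (b x) (G x) ∂μ = κ * (∫ x, inner ℝ (wgrad g x) (G x) ∂μ)
        + ν * (∫ x, inner ℝ (S x) (G x) ∂μ) - ∫ x, inner ℝ (O x) (G x) ∂μ := by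
    intro G hG2 hGp
    have hconj : ENNReal.HolderConjugate (ENNReal.ofReal (p / (p - 1))) (ENNReal.ofReal p) :=
      (Real.HolderConjugate.conjExponent hp).symm.ennrealOfReal
    have hin : ∀ {A : Vec d → Mat d}, MemLp A 2 μ → Integrable (fun x => inner ℝ (A x) (G x)) μ :=
      fun hA => memLp_one_iff_integrable.1
        ((innerSL ℝ : Mat d →L[ℝ] Mat d →L[ℝ] ℝ).memLp_of_bilin 1 hA hG2)
    have i1 : Integrable (fun x => κ * inner ℝ (wgrad g x) (G x)) μ :=
      (hin (memLp_wgrad g)).const_mul κ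
    have i2 : Integrable (fun x => ν * inner ℝ (S x) (G x)) μ :=
      (memLp_one_iff_integrable.1
        ((innerSL ℝ : Mat d →L[ℝ] Mat d →L[ℝ] ℝ).memLp_of_bilin 1 hSm hGp)).const_mul ν
    have i3 : Integrable (fun x => inner ℝ (O x) (G x)) μ := hin hOm
    have i12 : Integrable (fun x => κ * inner ℝ (wgrad g x) (G x) + ν * inner ℝ (S x) (G x)) μ :=
      i1.add i2
    rw [← integral_const_mul, ← integral_const_mul, ← integral_add i1 i2, ← integral_sub i12 i3]
    refine integral_congr_ae (Eventually.of_forall fun x => ?_)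
    simp only [hb, inner_sub_left, inner_add_left, real_inner_smul_left]
  have htest : ∀ φ ∈ D, (∫ x, inner ℝ (fld g x) (φ x) ∂μ)
      + ∫ x, inner ℝ (b x) (grad φ x) ∂μ = 0 := by
    intro φ hφD
    obtain ⟨hφ, he⟩ := h φ hφD
    rw [hsplit (hφ.memLp_grad _) (hφ.memLp_grad _)]
    rw [energyForm_toV] at he
    have e1 : ∫ x, inner ℝ (S x) (grad φ x) ∂μ = stressForm p u₁ φ - stressForm p u₂ φ := by
      unfold stressForm
      rw [← integral_sub (integrable_stress hp hD₁ hφ) (integrable_stress hp hD₂ hφ)]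
      refine integral_congr_ae (Eventually.of_forall fun x => ?_)
      simp only [hS, symGrad, inner_powerLaw_symPart, inner_sub_left]
    have e2 : ∫ x, inner ℝ (O x) (grad φ x) ∂μ = convForm u₁ φ - convForm u₂ φ := by
      unfold convForm
      rw [← integral_sub (integrable_conv (memLp_fld u₁) hφ) (integrable_conv (memLp_fld u₂) hφ)]
      refine integral_congr_ae (Eventually.of_forall fun x => ?_)
      simp only [hO, inner_sub_left]
    rw [e1, e2, ← he, residual]
    ring
  have hpair := pairing_eq_zero_of_dense (q := q) (q' := q')
    ((memLp_fld g).mono_exponent hq2) hbm hD htest z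
  have f1 : ∫ x, inner ℝ (fld g x) (fld z x) ∂μ
      = ∫ x, inner ℝ (fld g x) (fld (u₁ - u₂) x) ∂μ := by
    refine integral_congr_ae ?_
    filter_upwards [hz.1] with x hx
    rw [hx]
  have f2 : ∫ x, inner ℝ (b x) (wgrad z x) ∂μ
      = ∫ x, inner ℝ (b x) (wgrad (u₁ - u₂) x) ∂μ := by
    refine integral_congr_ae ?_
    filter_upwards [hz.2] with x hx
    rw [hx]
  have hGp : MemLp (wgrad (u₁ - u₂)) (ENNReal.ofReal p) μ :=
    (memLp_wgrad (w₁ - w₂)).ae_eq (hs₁.sub hs₂).2.symm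
  rw [f1, f2, hsplit (memLp_wgrad _) hGp] at hpair
  have hmono : 0 ≤ ∫ x, inner ℝ (S x) (wgrad (u₁ - u₂) x) ∂μ := by
    refine integral_nonneg_of_ae ?_
    filter_upwards [wgrad_sub u₁ u₂] with x hx
    have := inner_powerLaw_sub_nonneg hp (symGrad u₁ x) (symGrad u₂ x)
    simp only [symGrad, ← symPart_sub, inner_sub_left, inner_powerLaw_symPart] at this
    simpa only [hS, symGrad, hx, Pi.sub_apply, inner_sub_left, Pi.zero_apply] using this
  have hconv := (abs_le.1 (abs_integral_conv_sub_le hC hsob h₁ h₂)).2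
  rw [energyForm_apply]
  have := mul_nonneg hν.le hmono
  linarith

/-- The exponent `max 2 p`: fields in `V ∩ V_p` are approximated by test fields in both norms at
once. -/
theorem exists_common_exponent {p : ℝ} (hp : 1 < p) [Fact (1 ≤ ENNReal.ofReal p)] :
    ∃ q q' : ℝ≥0∞, ∃ (_ : Fact (1 ≤ q)), 1 ≤ q' ∧ ENNReal.HolderConjugate q' q ∧ q ≠ ⊤ ∧ q' ≤ 2 ∧
      q' ≤ ENNReal.ofReal (p / (p - 1)) ∧
      ∀ (u : V Ω 2) (w : V Ω (ENNReal.ofReal p)), SameField u w → ∃ z : V Ω q, SameField u z := by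
  rcases le_total p 2 with h | h
  · refine ⟨2, 2, inferInstance, by norm_num, inferInstance, ENNReal.ofNat_ne_top, le_rfl, ?_,
      fun u _ _ => ⟨u, EventuallyEq.rfl, EventuallyEq.rfl⟩⟩
    rw [← ENNReal.ofReal_ofNat]
    refine ENNReal.ofReal_le_ofReal ((le_div_iff₀ (by linarith)).2 (by linarith))
  · refine ⟨ENNReal.ofReal p, ENNReal.ofReal (p / (p - 1)), inferInstance, ?_,
      (Real.HolderConjugate.conjExponent hp).symm.ennrealOfReal, ENNReal.ofReal_ne_top, ?_, le_rfl,
      fun u w hw => ⟨w, hw⟩⟩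
    · rw [← ENNReal.ofReal_one]
      exact ENNReal.ofReal_le_ofReal ((one_le_div (by linarith)).2 (by linarith))
    · rw [← ENNReal.ofReal_ofNat]
      exact ENNReal.ofReal_le_ofReal ((div_le_iff₀ (by linarith)).2 (by linarith))

end Energy

end NSV

theorem theorem3p2 {d : ℕ} (hd2 : 2 ≤ d) (hd4 : d ≤ 4)
    (Ω : Set (NSV.Vec d)) (hΩ_open : IsOpen Ω) (hΩ_conn : IsConnected Ω)
    (hΩ_bdd : Bornology.IsBounded Ω) (hΩ_C2 : NSV.HasC2Boundary Ω)
    (T κ ν p : ℝ) (hT : 0 < T) (hκ : 0 < κ) (hν : 0 < ν)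
    (hp : 2 * (d : ℝ) / ((d : ℝ) + 2) < p) [Fact (1 ≤ ENNReal.ofReal p)]
    (f : ℝ → NSV.Vec d → NSV.Vec d)
    (hf : MemLp (Function.uncurry f) (ENNReal.ofReal (p / (p - 1)))
      (volume.restrict (Ioo 0 T ×ˢ Ω)))
    (v₀ : NSV.V Ω 2) (hv₀ : ∃ u : NSV.V Ω (ENNReal.ofReal p), NSV.SameField v₀ u)
    (v₁ v₂ : ℝ → NSV.V Ω 2)
    (hv₁ : NSV.IsWeakSolution Ω T κ ν p f v₀ v₁)
    (hv₂ : NSV.IsWeakSolution Ω T κ ν p f v₀ v₂) :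
    ∀ᵐ t ∂NSV.timeMeasure T, v₁ t = v₂ t := by
  have hp1 : 1 < p := by
    refine lt_of_le_of_lt ?_ hp
    have : (2 : ℝ) ≤ d := by exact_mod_cast hd2
    rw [one_le_div (by linarith)]
    linarith
  have hfin : IsFiniteMeasure (volume.restrict Ω) := ⟨by simpa using hΩ_bdd.measure_lt_top⟩
  obtain ⟨g₁, hg₁m, hg₁⟩ := hv₁.timeDeriv_memLp
  obtain ⟨g₂, hg₂m, hg₂⟩ := hv₂.timeDeriv_memLp
  have hi₁ : Integrable g₁ (NSV.timeMeasure T) := hg₁m.integrable (by norm_num)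
  have hi₂ : Integrable g₂ (NSV.timeMeasure T) := hg₂m.integrable (by norm_num)
  set g : ℝ → NSV.V Ω 2 := fun t => g₁ t - g₂ t
  have hi : Integrable g (NSV.timeMeasure T) := hi₁.sub hi₂
  have hg := NSV.IsWeakTimeDeriv.sub hv₁.integrable hv₂.integrable hi₁ hi₂ hg₁ hg₂
  have hprim := NSV.ae_eq_primitive (hv₁.integrable.sub hv₂.integrable) hi
    fun η hη hηc hηs => NSV.integral_deriv_smul_eq_neg hκ hp1 hv₁ hv₂ hi hg hη hηc hηs
  obtain ⟨C, hC, hsob⟩ := NSV.exists_eLpNorm_four_le hd2 hd4 hΩ_bdd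
  obtain ⟨q, q', hq1, hq'1, hqq, hqtop, hq2, hqp, hlift⟩ :=
    NSV.exists_common_exponent (Ω := Ω) hp1
  have : Fact (1 ≤ q') := ⟨hq'1⟩
  obtain ⟨D, hDc, hDs, hD⟩ := NSV.exists_countable_dense_solenoidal (Ω := Ω) hqtop
  have heq : ∀ᵐ t ∂NSV.timeMeasure T, ∀ φ ∈ D, ∃ hφ : NSV.IsSolenoidal Ω φ,
      NSV.energyForm Ω κ (g t) (hφ.toV 2) + NSV.residual ν p (v₁ t) (v₂ t) φ = 0 := by
    rw [ae_ball_iff hDc]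
    intro φ hφD
    filter_upwards [NSV.ae_energyForm_add_residual hp1 hv₁ hv₂ hi hg (hDs φ hφD)] with t ht
      using ⟨hDs φ hφD, ht⟩
  obtain ⟨w₁, -, hw₁⟩ := hv₁.memLp_p
  obtain ⟨w₂, -, hw₂⟩ := hv₂.memLp_p
  obtain ⟨R₁, hR₁⟩ := hv₁.exists_ae_norm_le
  obtain ⟨R₂, hR₂⟩ := hv₂.exists_ae_norm_le
  have henergy : ∀ᵐ t ∂NSV.timeMeasure T, NSV.energyForm Ω κ (g t) (v₁ t - v₂ t)
      ≤ 2 * C ^ 2 * |max R₁ R₂| * ‖v₁ t - v₂ t‖ ^ 2 := by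
    filter_upwards [heq, hw₁, hw₂, hR₁, hR₂] with t ht h1 h2 h3 h4
    obtain ⟨z, hz⟩ := hlift _ _ (h1.sub h2)
    exact NSV.energyForm_sub_le hν hp1 hq2 hqp hD hC hsob h1 h2
      (h3.trans ((le_max_left _ _).trans (le_abs_self _)))
      (h4.trans ((le_max_right _ _).trans (le_abs_self _))) hz ht
  have hzero := NSV.primitive_eq_zero_of_energy_le (NSV.energyForm Ω κ)
    (NSV.energyForm_symm κ) (lt_min one_pos hκ) (NSV.energyForm_coercive hκ) hi
    (K := 2 * C ^ 2 * |max R₁ R₂|) (by positivity) (by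
      filter_upwards [henergy, hprim] with t h1 h2
      rw [← h2]
      exact h1)
  filter_upwards [hprim, ae_restrict_mem measurableSet_Ioo] with t h1 ht
  exact sub_eq_zero.1 (h1.trans (hzero t ht))
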